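/- Let $d\ge 1$ and let $G\subset\mathbb R^d$ be a nonempty bounded open set with inradius $g=\sup\{\varepsilon>0: G \text{ contains a ball of radius } \varepsilon\}$. For a bounded set $A\subset\mathbb R^d$ let $V(A,\varepsilon)$ be the Lebesgue measure of $\{x\in A:\operatorname{dist}(x,\partial A)\le\varepsilon\}$. Suppose $G$ is monophase: there are real constants $\kappa_0,\dots,\kappa_{d-1}$ with $V(G,\varepsilon)=\sum_{k=0}^{d-1}\kappa_k\varepsilon^{d-k}$ for $0<\varepsilon<g$; put $\kappa_d=-\operatorname{vol}_d(G)$. Let $T\subset\mathbb R^d$ be a fractal spray on $G$: a bounded open set which is the disjoint union of countably (finitely or infinitely) many open sets $\Omega_n$, with $\Omega_n$ congruent to $\rho_nG$, $\rho_n>0$. Let $\eta=\sum_n\delta_{1/\rho_n}$ be its scaling measure, and assume that the scaling zeta function $\zeta(s)=\int_0^\infty x^{-s}\,d\eta(x)=\sum_n\rho_n^s$ ($\operatorname{Re}s$ large) has a meromorphic extension to $\mathbb C$, again denoted $\zeta$, which is strongly languid, that is, there are * a sequence $(T_n)_{n\in\mathbb Z}$ of reals with $T_{-n}<0<T_n$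 for $n\ge1$, $T_n\to\infty$, $T_{-n}\to-\infty$ and $T_n/|T_{-n}|\to1$ as $n\to\infty$; * bounded functions $f_m:\mathbb R\to\mathbb R$ ($m\ge1$), Lipschitz with a common constant, with $\sup f_m\to-\infty$ as $m\to\infty$, defining the windows $W_m=\{z:\operatorname{Re}z\ge f_m(\operatorname{Im}z)\}$; and * a constant $A>0$, such that * (L1, relative to the window of every $f_m$) for every $m$ there are real $M_m$ and $c_m>0$ with $|\zeta(\sigma+iT_n)|\le c_m(|T_n|+1)^{M_m}$ for all $n\in\mathbb Z$ and $\sigma\ge f_m(T_n)$; * (L2') there are real $M$ and $c>0$ with $|\zeta(f_m(t)+it)|\le c\,A^{|f_m(t)|}(|t|+1)^{M}$ for all $t\in\mathbb R$ and $m\ge1$. Let $\mathcal D_T$ be the set of poles of $\zeta$ together with $\{0,1,\dots,d-1\}$, and let $$\zeta_T(\varepsilon,s)=\varepsilon^{d-s}\,\zeta(s)\sum_{k=0}^{d}\frac{g^{s-k}}{s-k}\,\kappa_k .$$ Then one may take $W=\mathbb C$ and there is no error term: $$V(T,\varepsilon)=\sum_{\omega\in\mathcal D_T}\operatorname{res}\bigl(\zeta_T(\varepsilon,s);s=\omega\bigr)$$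 as an identity of distributions on $(0,g/A)$. Explicitly, for every $\varphi\in C_c^\infty(0,\infty)$ with support in $(0,g/A)$, $$\int_0^\infty V(T,\varepsilon)\varphi(\varepsilon)\,d\varepsilon=\lim_{m\to\infty}\ \lim_{n\to\infty}\ \sum_{\substack{\omega\in\mathcal D_T\cap W_m\\ T_{-n}<\operatorname{Im}\omega<T_n}}\operatorname{res}\Bigl(\int_0^\infty\zeta_T(\varepsilon,s)\varphi(\varepsilon)\,d\varepsilon;\,s=\omega\Bigr),$$ where each of the sums is finite, the inner limit exists for all sufficiently large $m$, and the outer limit exists. -/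

import Mathlib

open Set Filter Topology MeasureTheory
open scoped Pointwise ContDiff NNReal

noncomputable section

namespace FractalSpray

/-! ### Inner neighbourhoods, inradius, monophase generators, sprays -/

/-- Euclidean space of dimension `d`. -/
abbrev E (d : ℕ) : Type := EuclideanSpace ℝ (Fin d)

/-- `V(A, ε)`: the Lebesgue measure of the inner `ε`-neighbourhood
`{x ∈ A | dist(x, ∂A) ≤ ε}` of `A`. -/
def tubeVolume {d : ℕ} (A : Set (E d)) (ε : ℝ) : ℝ :=
  (volume {x ∈ A | Metric.infDist x (frontier A) ≤ ε}).toReal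

/-- The inradius of `A`: the supremum of the radii of the balls contained in `A`. -/
def inradius {d : ℕ} (A : Set (E d)) : ℝ :=
  sSup {ε : ℝ | 0 < ε ∧ ∃ x, Metric.ball x ε ⊆ A}

/-- `G` is a generator: a nonempty bounded open set. -/
structure IsGenerator {d : ℕ} (G : Set (E d)) : Prop where
  nonempty : G.Nonempty
  isOpen : IsOpen G
  isBounded : Bornology.IsBounded G

/-- `G` has a monophase tube formula with coefficients `κ 0, …, κ (d-1)`; the last
coefficient `κ d` is, by convention, minus the volume of `G`. -/
structure IsMonophase {d : ℕ} (G : Set (E d)) (κ : ℕ → ℝ) : Prop where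
  tube : ∀ ε : ℝ, 0 < ε → ε < inradius G →
    tubeVolume G ε = ∑ k ∈ Finset.range d, κ k * ε ^ (d - k)
  top : κ d = -(volume G).toReal

/-- `T` is a fractal spray on `G` with scaling factors `ρ`: a bounded open set which is the
disjoint union of open sets `Ω n`, where `Ω n` is congruent to the homothetic copy
`ρ n • G` of `G`. -/
structure IsFractalSpray {d : ℕ} {ι : Type*} (G : Set (E d)) (ρ : ι → ℝ) (T : Set (E d)) :
    Prop where
  pos : ∀ n, 0 < ρ n
  isBounded : Bornology.IsBounded T
  tiles : ∃ Ω : ι → Set (E d),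
    (∀ n, IsOpen (Ω n)) ∧
    (∀ n, ∃ e : E d ≃ᵢ E d, Ω n = e '' (ρ n • G)) ∧
    Pairwise (fun m n => Disjoint (Ω m) (Ω n)) ∧
    T = ⋃ n, Ω n

/-! ### Scaling measure, zeta functions, complex dimensions -/

/-- The scaling measure `∑ₙ δ_{1/ρₙ}`. -/
def scalingMeasure {ι : Type*} (ρ : ι → ℝ) : Measure ℝ :=
  Measure.sum fun n => Measure.dirac (1 / ρ n)

/-- `ζ` is the (meromorphic extension to `ℂ` of the) scaling zeta function of the measure
`η`: it is meromorphic on `ℂ` and in some right half-plane it is given by the absolutely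
convergent integral `∫₀^∞ x^{-s} dη(x)`. -/
structure IsScalingZeta (η : Measure ℝ) (ζ : ℂ → ℂ) : Prop where
  meromorphic : Meromorphic ζ
  eq_integral : ∃ σ₀ : ℝ, ∀ s : ℂ, σ₀ < s.re →
    IntegrableOn (fun x : ℝ => (x : ℂ) ^ (-s)) (Ioi 0) η ∧
    ζ s = ∫ x in Ioi (0 : ℝ), (x : ℂ) ^ (-s) ∂η

/-- The scaling dimensions: the poles of the scaling zeta function. -/
def scalingDimensions (ζ : ℂ → ℂ) : Set ℂ :=
  {w | meromorphicOrderAt ζ w < 0}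

/-- The complex dimensions of the spray: the scaling dimensions together with the integral
dimensions `0, 1, …, d-1`. -/
def complexDimensions (d : ℕ) (ζ : ℂ → ℂ) : Set ℂ :=
  scalingDimensions ζ ∪ {w | ∃ k : ℕ, k < d ∧ w = (k : ℂ)}

/-- The tubular zeta function `ε^{d-s} ζ(s) ∑_{k=0}^{d} g^{s-k} κ_k / (s-k)`. -/
def tubularZeta (d : ℕ) (g : ℝ) (κ : ℕ → ℝ) (ζ : ℂ → ℂ) (ε : ℝ) (s : ℂ) : ℂ :=
  (ε : ℂ) ^ ((d : ℂ) - s) * ζ s *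
    ∑ k ∈ Finset.range (d + 1), (g : ℂ) ^ (s - (k : ℂ)) / (s - (k : ℂ)) * (κ k : ℂ)

/-! ### Distributions on `(0, ∞)` and residues -/

/-- The action `∫₀^∞ u(ε) φ(ε) dε` of a function `u` on a test function `φ`. -/
def action (u : ℝ → ℂ) (φ : ℝ → ℂ) : ℂ :=
  ∫ ε in Ioi (0 : ℝ), u ε * φ ε

/-- Smooth functions with compact support contained in the open set `U`. -/
structure IsTestFunction (U : Set ℝ) (φ : ℝ → ℂ) : Prop where
  smooth : ContDiff ℝ ∞ φ
  compact : HasCompactSupport φ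
  support_subset : tsupport φ ⊆ U

/-- The residue of `F` at `w`: the limit, as `r → 0+`, of `(2πi)⁻¹ ∮_{|s-w| = r} F(s) ds`. -/
def residue (F : ℂ → ℂ) (w : ℂ) : ℂ :=
  limUnder (𝓝[>] (0 : ℝ)) fun r =>
    (2 * (Real.pi : ℂ) * Complex.I)⁻¹ * ∮ s in C(w, r), F s

/-- The residue at `w` of a distribution-valued meromorphic function `s ↦ Z(·, s)`; it is the
distribution `φ ↦ res (⟨Z(·, s), φ⟩; s = w)`. -/
def distResidue (Z : ℝ → ℂ → ℂ) (w : ℂ) (φ : ℝ → ℂ) : ℂ :=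
  residue (fun s => action (fun ε => Z ε s) φ) w

/-! ### Screens, windows, languidity -/

/-- `f` defines a screen `{f(t) + i t}`: it is bounded and Lipschitz. -/
def IsScreen (f : ℝ → ℝ) : Prop :=
  (∃ C : ℝ, ∀ t, |f t| ≤ C) ∧ ∃ K : ℝ≥0, LipschitzWith K f

/-- The window to the right of the screen defined by `f`. -/
def window (f : ℝ → ℝ) : Set ℂ :=
  {z | f z.im ≤ z.re}

/-- The conditions on the sequence of heights `(Tₙ)_{n ∈ ℤ}`. -/
structure IsHeightSequence (τ : ℤ → ℝ) : Prop where
  neg : ∀ n : ℕ, 1 ≤ n → τ (-(n : ℤ)) < 0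
  pos : ∀ n : ℕ, 1 ≤ n → 0 < τ (n : ℤ)
  tendsto_top : Tendsto (fun n : ℕ => τ (n : ℤ)) atTop atTop
  tendsto_bot : Tendsto (fun n : ℕ => τ (-(n : ℤ))) atTop atBot
  ratio : Tendsto (fun n : ℕ => τ (n : ℤ) / |τ (-(n : ℤ))|) atTop (𝓝 1)

/-- Condition L1 relative to the screen `f`: a polynomial bound on the horizontal half-lines
`{σ + i Tₙ | σ ≥ f(Tₙ)}`. -/
def LanguidL1 (ζ : ℂ → ℂ) (τ : ℤ → ℝ) (f : ℝ → ℝ) : Prop :=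
  ∃ M c : ℝ, 0 < c ∧ ∀ n : ℤ, ∀ σ : ℝ, f (τ n) ≤ σ →
    ‖ζ ((σ : ℂ) + (τ n : ℂ) * Complex.I)‖ ≤ c * (|τ n| + 1) ^ M

/-- `ζ` is strongly languid, with heights `τ`, screens `f 0, f 1, …` and constant `A`. As the
windows of the screens exhaust `ℂ`, condition L1 is required relative to each of them. -/
structure IsStronglyLanguid (ζ : ℂ → ℂ) (τ : ℤ → ℝ) (f : ℕ → ℝ → ℝ) (A : ℝ) : Prop where
  heights : IsHeightSequence τ
  screens : ∀ m, IsScreen (f m)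
  uniform_lipschitz : ∃ K : ℝ≥0, ∀ m, LipschitzWith K (f m)
  sup_tendsto : Tendsto (fun m => ⨆ t, f m t) atTop atBot
  pos : 0 < A
  languid : ∀ m, LanguidL1 ζ τ (f m)
  bound : ∃ M c : ℝ, 0 < c ∧ ∀ m : ℕ, ∀ t : ℝ,
    ‖ζ ((f m t : ℂ) + (t : ℂ) * Complex.I)‖ ≤ c * A ^ |f m t| * (|t| + 1) ^ M

/-! ### Sums over the complex dimensions -/

/-- The part of `D` in the window of `f` and between the heights `T₋ₙ` and `Tₙ`. -/
def truncation (D : Set ℂ) (τ : ℤ → ℝ) (f : ℝ → ℝ) (n : ℕ) : Set ℂ :=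
  {w ∈ D | w ∈ window f ∧ τ (-(n : ℤ)) < w.im ∧ w.im < τ (n : ℤ)}

/-- `∑_{w ∈ D} a w = v`. All truncations of `D` are finite; for (almost) every screen the sum
over the visible part of `D` converges as the limit of the sums between the heights `T₋ₙ`
and `Tₙ`; and the sums over the visible parts converge to `v` as the windows exhaust `ℂ`. -/
def HasDimensionSum (D : Set ℂ) (τ : ℤ → ℝ) (f : ℕ → ℝ → ℝ) (a : ℂ → ℂ) (v : ℂ) : Prop :=
  (∀ m n, (truncation D τ (f m) n).Finite) ∧
  ∃ L : ℕ → ℂ,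
    (∀ᶠ m in atTop,
      Tendsto (fun n => ∑ᶠ w ∈ truncation D τ (f m) n, a w) atTop (𝓝 (L m))) ∧
    Tendsto L atTop (𝓝 v)

end FractalSpray

end

namespace FractalSpray

/-! ### Residues -/

theorem residue_congr {F G : ℂ → ℂ} {w : ℂ} (h : F =ᶠ[𝓝[≠] w] G) :
    residue F w = residue G w := by
  unfold residue limUnder
  congr 1
  apply Filter.map_congr
  obtain ⟨r, hr, hFG⟩ := Metric.eventually_nhds_iff.1 (eventually_nhdsWithin_iff.1 h)
  filter_upwards [Ioo_mem_nhdsGT hr] with t ht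
  congr 1
  refine circleIntegral.integral_congr ht.1.le fun s hs => hFG ?_ ?_
  · rw [Metric.mem_sphere] at hs
    linarith [ht.2]
  · rintro rfl
    rw [Metric.mem_sphere, dist_self] at hs
    linarith [ht.1]

/-- The residue of a function which, up to a derivative, is `a / (s - w)`. -/
theorem residue_eq {F H : ℂ → ℂ} {w a : ℂ}
    (h : ∀ᶠ s in 𝓝[≠] w, HasDerivAt H (F s - a / (s - w)) s) : residue F w = a := by
  obtain ⟨r, hr, hH⟩ := Metric.eventually_nhds_iff.1 (eventually_nhdsWithin_iff.1 h)
  refine Tendsto.limUnder_eq (tendsto_const_nhds.congr' ?_)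
  filter_upwards [Ioo_mem_nhdsGT hr] with t ht
  have hmem : ∀ s ∈ Metric.sphere w t, HasDerivAt H (F s - a / (s - w)) s := fun s hs => by
    rw [Metric.mem_sphere] at hs
    refine hH (by linarith [ht.2]) ?_
    rintro rfl
    rw [dist_self] at hs
    linarith [ht.1]
  have hint : CircleIntegrable (fun s => a / (s - w)) w t := by
    refine ContinuousOn.circleIntegrable ht.1.le fun s hs => ?_
    have : s - w ≠ 0 := by
      rintro h0
      rw [Metric.mem_sphere, dist_eq_norm, h0, norm_zero] at hs
      linarith [ht.1]
    exact ContinuousAt.continuousWithinAt (by fun_prop (disch := exact this))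
  have h1 : ∮ s in C(w, t), a / (s - w) = a * (2 * Real.pi * Complex.I) := by
    simp_rw [div_eq_mul_inv]
    rw [circleIntegral.integral_const_mul, circleIntegral.integral_sub_center_inv w ht.1.ne']
  have hF : CircleIntegrable F w t := by
    have hopen : IsOpen (Metric.ball w r \ {w}) := Metric.isOpen_ball.sdiff isClosed_singleton
    have hsub : Metric.sphere w t ⊆ Metric.ball w r \ {w} := fun s hs => by
      rw [Metric.mem_sphere] at hs
      refine ⟨Metric.mem_ball.2 (by linarith [ht.2]), ?_⟩
      rintro rfl
      rw [dist_self] at hs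
      linarith [ht.1]
    have hd : DifferentiableOn ℂ H (Metric.ball w r \ {w}) := fun s hs =>
      (hH hs.1 hs.2).differentiableAt.differentiableWithinAt
    have hc : ContinuousOn (fun s => F s - a / (s - w)) (Metric.sphere w t) :=
      ((hd.deriv hopen).continuousOn.mono hsub).congr fun s hs => (hmem s hs).deriv.symm
    have hsum : (fun s => F s - a / (s - w)) + (fun s => a / (s - w)) = F := by
      funext s
      simp
    rw [← hsum]
    exact (hc.circleIntegrable ht.1.le).add hint
  have h0 : ∮ s in C(w, t), (F s - a / (s - w)) = 0 :=
    circleIntegral.integral_eq_zero_of_hasDerivWithinAt ht.1.le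
      fun s hs => (hmem s hs).hasDerivWithinAt
  rw [circleIntegral.integral_sub hF hint, sub_eq_zero] at h0
  rw [h0, h1]
  have : (Real.pi : ℂ) ≠ 0 := by exact_mod_cast Real.pi_ne_zero
  field_simp

theorem exists_principal_part_of_pow (w : ℂ) (n : ℕ) :
    ∀ g : ℂ → ℂ, AnalyticAt ℂ g w → ∃ (a : ℂ) (H h : ℂ → ℂ),
      (∀ s, s ≠ w → AnalyticAt ℂ H s) ∧ AnalyticAt ℂ h w ∧
      ∀ s, s ≠ w → ((s - w) ^ n)⁻¹ * g s = a / (s - w) + deriv H s + h s := by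
  induction n with
  | zero =>
    intro g hg
    exact ⟨0, fun _ => 0, g, fun s _ => analyticAt_const, hg, fun s _ => by simp⟩
  | succ n ih =>
    intro g hg
    have hd : AnalyticAt ℂ (dslope g w) w := by
      obtain ⟨p, hp⟩ := hg
      exact hp.has_fpower_series_dslope_fslope.analyticAt
    obtain ⟨a, H, h, hH, hh, heq⟩ := ih _ hd
    have key : ∀ s, s ≠ w → ((s - w) ^ (n + 1))⁻¹ * g s =
        ((s - w) ^ (n + 1))⁻¹ * g w + ((s - w) ^ n)⁻¹ * dslope g w s := fun s hs => by
      have h0 : s - w ≠ 0 := sub_ne_zero.2 hs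
      rw [dslope_of_ne _ hs, slope_def_field]
      field_simp
      ring
    rcases n with _ | n
    · refine ⟨g w + a, H, h, hH, hh, fun s hs => ?_⟩
      rw [key s hs, heq s hs]
      have h0 : s - w ≠ 0 := sub_ne_zero.2 hs
      field_simp
      ring
    · have hA : ∀ s, s ≠ w → AnalyticAt ℂ
          (fun s => ((s - w) ^ (n + 1))⁻¹ * (-(g w) / (n + 1))) s := fun s hs => by
        have h0 : (s - w) ^ (n + 1) ≠ 0 := pow_ne_zero _ (sub_ne_zero.2 hs)
        exact AnalyticAt.mul (AnalyticAt.inv (by fun_prop) h0) analyticAt_const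
      refine ⟨a, fun s => ((s - w) ^ (n + 1))⁻¹ * (-(g w) / (n + 1)) + H s, h,
        fun s hs => (hA s hs).add (hH s hs), hh, fun s hs => ?_⟩
      have h0 : s - w ≠ 0 := sub_ne_zero.2 hs
      have hder : HasDerivAt (fun s => ((s - w) ^ (n + 1))⁻¹ * (-(g w) / (n + 1)))
          (((s - w) ^ (n + 2))⁻¹ * g w) s := by
        have h1 : HasDerivAt (fun s : ℂ => (s - w) ^ (n + 1))
            (((n + 1 : ℕ) : ℂ) * (s - w) ^ n * 1) s :=
          ((hasDerivAt_id s).sub_const w).pow (n + 1)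
        refine ((h1.inv (pow_ne_zero _ h0)).mul_const (-(g w) / (n + 1))).congr_deriv ?_
        have : (n : ℂ) + 1 ≠ 0 := by exact_mod_cast n.succ_ne_zero
        push_cast
        field_simp
        ring
      have hadd : deriv (fun s => ((s - w) ^ (n + 1))⁻¹ * (-(g w) / (n + 1)) + H s) s =
          ((s - w) ^ (n + 2))⁻¹ * g w + deriv H s :=
        (hder.add (hH s hs).differentiableAt.hasDerivAt).deriv
      rw [key s hs, heq s hs, hadd]
      ring

theorem exists_principal_part {F : ℂ → ℂ} {w : ℂ} (hF : MeromorphicAt F w) :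
    ∃ (a : ℂ) (H h : ℂ → ℂ), (∀ s, s ≠ w → AnalyticAt ℂ H s) ∧ AnalyticAt ℂ h w ∧
      ∀ s, s ≠ w → F s = a / (s - w) + deriv H s + h s := by
  obtain ⟨n, hn⟩ := hF
  obtain ⟨a, H, h, hH, hh, heq⟩ := exists_principal_part_of_pow w n _ hn
  refine ⟨a, H, h, hH, hh, fun s hs => ?_⟩
  have h0 : s - w ≠ 0 := sub_ne_zero.2 hs
  rw [← heq s hs, smul_eq_mul, inv_mul_cancel_left₀ (pow_ne_zero _ h0)]

theorem AnalyticAt.exists_primitive {h : ℂ → ℂ} {w : ℂ} (hh : AnalyticAt ℂ h w) :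
    ∃ H : ℂ → ℂ, ∀ᶠ s in 𝓝 w, HasDerivAt H (h s) s := by
  obtain ⟨r, hr, hb⟩ := Metric.eventually_nhds_iff_ball.1 hh.eventually_analyticAt
  obtain ⟨H, hH⟩ := DifferentiableOn.isExactOn_ball (c := w) (r := r) (f := h)
    fun s hs => (hb s hs).differentiableAt.differentiableWithinAt
  exact ⟨H, Metric.eventually_nhds_iff_ball.2 ⟨r, hr, hH⟩⟩

theorem residue_eq_zero_of_analyticAt {F : ℂ → ℂ} {w : ℂ} (hF : AnalyticAt ℂ F w) :
    residue F w = 0 := by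
  obtain ⟨H, hH⟩ := AnalyticAt.exists_primitive hF
  refine residue_eq (H := H) ?_
  filter_upwards [hH.filter_mono nhdsWithin_le_nhds] with s hs
  simpa using hs

theorem finite_not_analyticAt {F : ℂ → ℂ} (hF : Meromorphic F) (r : ℝ) :
    {w ∈ Metric.closedBall (0 : ℂ) r | ¬ AnalyticAt ℂ F w}.Finite := by
  by_contra hinf
  obtain ⟨z, -, hz⟩ := Set.Infinite.exists_accPt_of_subset_isCompact hinf
    (isCompact_closedBall (0 : ℂ) r) fun w hw => hw.1
  obtain ⟨w, hw1, hw2⟩ := ((accPt_iff_frequently_nhdsNE.1 hz).and_eventually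
    (hF z).eventually_analyticAt).exists
  exact hw1.2 hw2

/-- A meromorphic function is, on a disc and off a finite set of points, the sum of a derivative
and of its simple polar parts. -/
theorem exists_primitive_off_poles {F : ℂ → ℂ} (hF : Meromorphic F) (r : ℝ) :
    ∃ (P : Finset ℂ) (H : ℂ → ℂ), (∀ w ∈ P, ¬ AnalyticAt ℂ F w) ∧
      (∀ w ∈ Metric.ball (0 : ℂ) r, ¬ AnalyticAt ℂ F w → w ∈ P) ∧
      ∀ s ∈ Metric.ball (0 : ℂ) r, s ∉ P → AnalyticAt ℂ H s ∧
        deriv H s = F s - ∑ w ∈ P, residue F w / (s - w) := by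
  have hfin := finite_not_analyticAt hF r
  choose a Hw hw hHw hhw heq using fun w => exists_principal_part (hF w)
  have hres : ∀ w, residue F w = a w := fun w => by
    obtain ⟨H', hH'⟩ := AnalyticAt.exists_primitive (hhw w)
    refine residue_eq (H := fun s => Hw w s + H' s) ?_
    filter_upwards [hH'.filter_mono nhdsWithin_le_nhds, self_mem_nhdsWithin] with s hs hsw
    have h1 : F s - a w / (s - w) = deriv (Hw w) s + hw w s := by
      rw [heq w s hsw]
      ring
    rw [h1]
    exact (hHw w s hsw).differentiableAt.hasDerivAt.add hs
  set P := hfin.toFinset with hP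
  let q : ℂ → ℂ → ℂ := fun w s => a w / (s - w) + deriv (Hw w) s
  have hq : ∀ w s, s ≠ w → AnalyticAt ℂ (q w) s := fun w s hs =>
    (AnalyticAt.fun_div analyticAt_const (analyticAt_id.sub analyticAt_const)
      (sub_ne_zero.2 hs)).add (hHw w s hs).deriv
  let G : ℂ → ℂ := fun s => F s - ∑ w ∈ P, q w s
  have hG : ∀ s ∈ Metric.ball (0 : ℂ) r, ∃ k, AnalyticAt ℂ k s ∧ G =ᶠ[𝓝[≠] s] k := by
    intro s hs
    by_cases hsP : s ∈ P
    · refine ⟨fun z => hw s z - ∑ w ∈ P.erase s, q w z, ?_, ?_⟩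
      · refine (hhw s).sub (Finset.analyticAt_fun_sum _ fun w hw => hq w s ?_)
        exact (Finset.ne_of_mem_erase hw).symm
      · filter_upwards [self_mem_nhdsWithin] with z hz
        simp only [G, q, ← Finset.add_sum_erase P _ hsP]
        rw [heq s z hz]
        ring
    · have : AnalyticAt ℂ F s := by
        by_contra hc
        exact hsP (by simpa [hP, hc] using (Metric.mem_ball.1 hs).le)
      refine ⟨G, this.sub (Finset.analyticAt_fun_sum _ fun w hw => hq w s ?_), EventuallyEq.rfl⟩
      rintro rfl
      exact hsP hw
  have hGm : ∀ s ∈ Metric.ball (0 : ℂ) r, MeromorphicAt G s := fun s hs => by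
    obtain ⟨k, hk, hGk⟩ := hG s hs
    exact hk.meromorphicAt.congr hGk.symm
  let N := toMeromorphicNFOn G (Metric.ball 0 r)
  have hN : ∀ s ∈ Metric.ball (0 : ℂ) r, AnalyticAt ℂ N s := fun s hs => by
    obtain ⟨k, hk, hGk⟩ := hG s hs
    rw [← (meromorphicNFOn_toMeromorphicNFOn G (Metric.ball 0 r)
      hs).meromorphicOrderAt_nonneg_iff_analyticAt,
      meromorphicOrderAt_congr ((MeromorphicOn.toMeromorphicNFOn_eq_self_on_nhdsNE hGm hs).trans hGk)]
    exact hk.meromorphicOrderAt_nonneg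
  obtain ⟨H0, hH0⟩ := DifferentiableOn.isExactOn_ball (c := 0) (r := r) (f := N)
    fun s hs => (hN s hs).differentiableAt.differentiableWithinAt
  refine ⟨P, fun s => H0 s + ∑ w ∈ P, Hw w s, fun w hw => ?_, fun w hwr hw => ?_,
    fun s hs hsP => ?_⟩
  · exact ((hfin.mem_toFinset).1 hw).2
  · simpa [hP, hw] using (Metric.mem_ball.1 hwr).le
  · have hne : ∀ w ∈ P, s ≠ w := by
      rintro w hw rfl
      exact hsP hw
    have hGs : AnalyticAt ℂ G s := by
      have : AnalyticAt ℂ F s := by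
        by_contra hc
        exact hsP (by simpa [hP, hc] using (Metric.mem_ball.1 hs).le)
      exact this.sub (Finset.analyticAt_fun_sum _ fun w hw => hq w s (hne w hw))
    have hNG : N s = G s := by
      have h1 := MeromorphicOn.toMeromorphicNFOn_eq_self_on_nhdsNE hGm hs
      exact (((hN s hs).continuousAt.eventuallyEq_nhds_iff_eventuallyEq_nhdsNE
        hGs.continuousAt).1 h1).eq_of_nhds
    have hA0 : AnalyticAt ℂ H0 s := by
      refine DifferentiableOn.analyticAt (s := Metric.ball 0 r)
        (fun z hz => (hH0 z hz).differentiableAt.differentiableWithinAt)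
        (Metric.isOpen_ball.mem_nhds hs)
    have hAs : AnalyticAt ℂ (fun s => ∑ w ∈ P, Hw w s) s :=
      Finset.analyticAt_fun_sum _ fun w hw => hHw w s (hne w hw)
    refine ⟨hA0.add hAs, ?_⟩
    have hd : HasDerivAt (fun s => H0 s + ∑ w ∈ P, Hw w s)
        (N s + ∑ w ∈ P, deriv (Hw w) s) s :=
      (hH0 s hs).add (HasDerivAt.fun_sum fun w hw =>
        (hHw w s (hne w hw)).differentiableAt.hasDerivAt)
    rw [hd.deriv, hNG]
    simp only [G, q, hres, Finset.sum_add_distrib]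
    ring

/-! ### Integrals over the boundary of a truncated window -/

/-- The point of the screen of `f` at height `t`. -/
def curve (f : ℝ → ℝ) (t : ℝ) : ℂ := (f t : ℂ) + (t : ℂ) * Complex.I

@[simp] theorem curve_re (f : ℝ → ℝ) (t : ℝ) : (curve f t).re = f t := by simp [curve]

@[simp] theorem curve_im (f : ℝ → ℝ) (t : ℝ) : (curve f t).im = t := by simp [curve]

theorem lipschitzWith_curve {f : ℝ → ℝ} {K : ℝ≥0} (hf : LipschitzWith K f) :
    LipschitzWith (K + 1) (curve f) := by
  refine LipschitzWith.of_dist_le_mul fun x y => ?_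
  have h : curve f x - curve f y = ((f x - f y : ℝ) : ℂ) + ((x - y : ℝ) : ℂ) * Complex.I := by
    simp only [curve]
    push_cast
    ring
  rw [dist_eq_norm, h]
  refine (norm_add_le _ _).trans ?_
  rw [norm_mul, Complex.norm_I, mul_one, Complex.norm_real, Complex.norm_real]
  have := hf.dist_le_mul x y
  rw [dist_eq_norm, dist_eq_norm] at this
  rw [dist_eq_norm]
  push_cast
  linarith

theorem continuous_curve {f : ℝ → ℝ} {K : ℝ≥0} (hf : LipschitzWith K f) : Continuous (curve f) :=
  (lipschitzWith_curve hf).continuous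

theorem hasDerivAt_curve {f : ℝ → ℝ} {t : ℝ} (hf : DifferentiableAt ℝ f t) :
    HasDerivAt (curve f) (((deriv f t : ℝ) : ℂ) + Complex.I) t := by
  have h1 : HasDerivAt (fun t : ℝ => (f t : ℂ)) ((deriv f t : ℝ) : ℂ) t := hf.hasDerivAt.ofReal_comp
  have h2 : HasDerivAt (fun t : ℝ => (t : ℂ) * Complex.I) (1 * Complex.I) t :=
    ((hasDerivAt_id t).ofReal_comp).mul_const _
  rw [one_mul] at h2
  exact h1.add h2

theorem intervalIntegrable_screen {f : ℝ → ℝ} {K : ℝ≥0} (hf : LipschitzWith K f) {g : ℝ → ℂ}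
    {a b : ℝ} (hg : ContinuousOn g (uIcc a b)) :
    IntervalIntegrable (fun t => (((deriv f t : ℝ) : ℂ) + Complex.I) * g t) volume a b := by
  have h : IntervalIntegrable (fun t => ((deriv f t : ℝ) : ℂ) + Complex.I) volume a b := by
    refine IntervalIntegrable.add ?_ intervalIntegrable_const
    refine (intervalIntegrable_const (c := (K : ℝ))).mono_fun ?_ (ae_of_all _ fun t => ?_)
    · exact (Complex.measurable_ofReal.comp (measurable_deriv f)).aestronglyMeasurable
    · change ‖((deriv f t : ℝ) : ℂ)‖ ≤ ‖(K : ℝ)‖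
      rw [Complex.norm_real]
      exact (norm_deriv_le_of_lipschitz hf).trans (le_abs_self _)
  exact h.mul_continuousOn hg

/-- The fundamental theorem of calculus along a screen. -/
theorem integral_screen_deriv {f : ℝ → ℝ} {K : ℝ≥0} (hf : LipschitzWith K f) {H : ℂ → ℂ}
    {a b : ℝ} (hab : a ≤ b) (hH : ∀ t ∈ Icc a b, AnalyticAt ℂ H (curve f t)) :
    ∫ t in a..b, (((deriv f t : ℝ) : ℂ) + Complex.I) * deriv H (curve f t) =
      H (curve f b) - H (curve f a) := by
  have hloc : LocallyLipschitzOn (Icc a b) (H ∘ curve f) := by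
    intro t ht
    obtain ⟨L, s, hs, hL⟩ := (hH t ht).hasStrictDerivAt.hasStrictFDerivAt.exists_lipschitzOnWith
    refine ⟨L * (K + 1), curve f ⁻¹' s, mem_nhdsWithin_of_mem_nhds
      ((continuous_curve hf).continuousAt.preimage_mem_nhds hs), ?_⟩
    exact hL.comp (lipschitzWith_curve hf).lipschitzOnWith (mapsTo_preimage _ _)
  obtain ⟨L, hL⟩ := hloc.exists_lipschitzOnWith_of_compact isCompact_Icc
  have hderiv : ∀ᵐ t : ℝ, t ∈ uIoc a b → HasDerivAt (H ∘ curve f)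
      ((((deriv f t : ℝ) : ℂ) + Complex.I) * deriv H (curve f t)) t := by
    filter_upwards [hf.ae_differentiableAt_real] with t ht htm
    rw [uIoc_of_le hab] at htm
    have := (hH t ⟨htm.1.le, htm.2⟩).differentiableAt.hasDerivAt.comp t (hasDerivAt_curve ht)
    rwa [mul_comm] at this
  have hint := intervalIntegrable_screen hf (g := fun t => deriv H (curve f t)) (a := a) (b := b)
    (fun t ht => by
      rw [uIcc_of_le hab] at ht
      exact ((hH t ht).deriv.continuousAt.comp
        (continuous_curve hf).continuousAt).continuousWithinAt)
  have hpart : ∀ l : ℂ →L[ℝ] ℝ, l (∫ t in a..b,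
      (((deriv f t : ℝ) : ℂ) + Complex.I) * deriv H (curve f t)) =
      l (H (curve f b) - H (curve f a)) := by
    intro l
    have hac : AbsolutelyContinuousOnInterval (fun t => l (H (curve f t))) a b := by
      refine LipschitzOnWith.absolutelyContinuousOnInterval (K := ‖l‖₊ * L) ?_
      rw [uIcc_of_le hab]
      exact l.lipschitz.comp_lipschitzOnWith hL
    rw [map_sub, ← hac.integral_deriv_eq_sub, ← ContinuousLinearMap.intervalIntegral_comp_comm l hint]
    refine intervalIntegral.integral_congr_ae ?_
    filter_upwards [hderiv] with t ht htm
    exact ((l.hasFDerivAt.comp_hasDerivAt t (ht htm)).deriv).symm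
  apply Complex.ext
  · exact hpart Complex.reCLM
  · exact hpart Complex.imCLM

/-- The integral of `g` along the screen of `f`, between the heights `a` and `b`. -/
noncomputable def screenIntegral (f : ℝ → ℝ) (a b : ℝ) (g : ℂ → ℂ) : ℂ :=
  ∫ t in a..b, (((deriv f t : ℝ) : ℂ) + Complex.I) * g (curve f t)

/-- The integral of `g` along the polygonal line from `f a + a i` through `c + a i` and `c + b i`
to `f b + b i`. -/
noncomputable def straightIntegral (f : ℝ → ℝ) (c a b : ℝ) (g : ℂ → ℂ) : ℂ :=
  (∫ σ in (f a)..c, g (σ + a * Complex.I)) + Complex.I * (∫ t in a..b, g (c + t * Complex.I)) -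
    ∫ σ in (f b)..c, g (σ + b * Complex.I)

/-- The boundary of the part of the window of `f` to the left of `c` and between the heights
`a` and `b`. -/
def windowBoundary (f : ℝ → ℝ) (c a b : ℝ) : Set ℂ :=
  {z | (a ≤ z.im ∧ z.im ≤ b ∧ f z.im ≤ z.re ∧ z.re ≤ c) ∧
    (z.im = a ∨ z.im = b ∨ z.re = c ∨ z.re = f z.im)}

section

variable {f : ℝ → ℝ} {K : ℝ≥0} {a b c : ℝ} (hf : LipschitzWith K f) (hab : a ≤ b)
  (hfc : ∀ t, f t ≤ c)

theorem curve_mem_windowBoundary (hfc : ∀ t, f t ≤ c) {t : ℝ} (ht : t ∈ Icc a b) :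
    curve f t ∈ windowBoundary f c a b := by
  simp [windowBoundary, ht.1, ht.2, hfc]

theorem horizontal_mem_windowBoundary {t σ : ℝ} (hab : a ≤ b) (ht : t = a ∨ t = b)
    (hσ : σ ∈ Icc (f t) c) : (σ : ℂ) + t * Complex.I ∈ windowBoundary f c a b := by
  rcases ht with rfl | rfl <;> simp [windowBoundary, hσ.1, hσ.2, hab]

theorem vertical_mem_windowBoundary (hfc : ∀ t, f t ≤ c) {t : ℝ} (ht : t ∈ Icc a b) :
    (c : ℂ) + t * Complex.I ∈ windowBoundary f c a b := by
  simp [windowBoundary, ht.1, ht.2, hfc]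

theorem intervalIntegrable_horizontal {g : ℂ → ℂ} {t : ℝ} (hab : a ≤ b) (hfc : ∀ t, f t ≤ c)
    (ht : t = a ∨ t = b) (hg : ContinuousOn g (windowBoundary f c a b)) :
    IntervalIntegrable (fun σ : ℝ => g (σ + t * Complex.I)) volume (f t) c := by
  refine (hg.comp (f := fun σ : ℝ => (σ : ℂ) + t * Complex.I) (by fun_prop)
    fun σ hσ => ?_).intervalIntegrable
  rw [uIcc_of_le (hfc t)] at hσ
  exact horizontal_mem_windowBoundary hab ht hσ

theorem intervalIntegrable_vertical {g : ℂ → ℂ} (hab : a ≤ b) (hfc : ∀ t, f t ≤ c)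
    (hg : ContinuousOn g (windowBoundary f c a b)) :
    IntervalIntegrable (fun t : ℝ => g (c + t * Complex.I)) volume a b := by
  refine (hg.comp (f := fun t : ℝ => (c : ℂ) + t * Complex.I) (by fun_prop)
    fun t ht => ?_).intervalIntegrable
  rw [uIcc_of_le hab] at ht
  exact vertical_mem_windowBoundary hfc ht

include hf hab hfc

theorem intervalIntegrable_screen_comp {g : ℂ → ℂ}
    (hg : ContinuousOn g (windowBoundary f c a b)) :
    IntervalIntegrable (fun t => (((deriv f t : ℝ) : ℂ) + Complex.I) * g (curve f t)) volume a b := by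
  refine intervalIntegrable_screen hf (hg.comp (continuous_curve hf).continuousOn fun t ht => ?_)
  rw [uIcc_of_le hab] at ht
  exact curve_mem_windowBoundary hfc ht

theorem screenIntegral_add {g h : ℂ → ℂ} (hg : ContinuousOn g (windowBoundary f c a b))
    (hh : ContinuousOn h (windowBoundary f c a b)) :
    screenIntegral f a b (fun s => g s + h s) = screenIntegral f a b g + screenIntegral f a b h := by
  simp only [screenIntegral, mul_add]
  exact intervalIntegral.integral_add (intervalIntegrable_screen_comp hf hab hfc hg)
    (intervalIntegrable_screen_comp hf hab hfc hh)

omit hf in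
theorem straightIntegral_add {g h : ℂ → ℂ} (hg : ContinuousOn g (windowBoundary f c a b))
    (hh : ContinuousOn h (windowBoundary f c a b)) :
    straightIntegral f c a b (fun s => g s + h s) =
      straightIntegral f c a b g + straightIntegral f c a b h := by
  simp only [straightIntegral]
  rw [intervalIntegral.integral_add, intervalIntegral.integral_add, intervalIntegral.integral_add]
  · ring
  all_goals first
    | exact intervalIntegrable_vertical hab hfc ‹_›
    | exact intervalIntegrable_horizontal hab hfc (Or.inl rfl) ‹_›
    | exact intervalIntegrable_horizontal hab hfc (Or.inr rfl) ‹_›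

omit hf in
theorem screenIntegral_congr {g h : ℂ → ℂ} (hgh : EqOn g h (windowBoundary f c a b)) :
    screenIntegral f a b g = screenIntegral f a b h := by
  refine intervalIntegral.integral_congr fun t ht => ?_
  rw [uIcc_of_le hab] at ht
  simp only [hgh (curve_mem_windowBoundary hfc ht)]

omit hf in
theorem straightIntegral_congr {g h : ℂ → ℂ} (hgh : EqOn g h (windowBoundary f c a b)) :
    straightIntegral f c a b g = straightIntegral f c a b h := by
  have h1 : ∀ t, t = a ∨ t = b → ∫ σ in (f t)..c, g (σ + t * Complex.I) =
      ∫ σ in (f t)..c, h (σ + t * Complex.I) := fun t ht => by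
    refine intervalIntegral.integral_congr fun σ hσ => ?_
    rw [uIcc_of_le (hfc t)] at hσ
    exact hgh (horizontal_mem_windowBoundary hab ht hσ)
  have h2 : ∫ t in a..b, g (c + t * Complex.I) = ∫ t in a..b, h (c + t * Complex.I) := by
    refine intervalIntegral.integral_congr fun t ht => ?_
    rw [uIcc_of_le hab] at ht
    exact hgh (vertical_mem_windowBoundary hfc ht)
  simp only [straightIntegral]
  rw [h1 a (Or.inl rfl), h1 b (Or.inr rfl), h2]

omit hfc in
theorem screenIntegral_eq_sub {g H : ℂ → ℂ}
    (hH : ∀ t ∈ Icc a b, AnalyticAt ℂ H (curve f t) ∧ deriv H (curve f t) = g (curve f t)) :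
    screenIntegral f a b g = H (curve f b) - H (curve f a) := by
  rw [← integral_screen_deriv hf hab fun t ht => (hH t ht).1]
  unfold screenIntegral
  refine intervalIntegral.integral_congr fun t ht => ?_
  rw [uIcc_of_le hab] at ht
  simp only [(hH t ht).2]

omit hf in
theorem straightIntegral_eq_sub {g H : ℂ → ℂ}
    (hH : ∀ s, (s.re = c ∧ s.im ∈ Icc a b) ∨ (s.im = a ∨ s.im = b) ∧ s.re ∈ Icc (f s.im) c →
      AnalyticAt ℂ H s ∧ deriv H s = g s) :
    straightIntegral f c a b g = H (curve f b) - H (curve f a) := by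
  have h1 : ∀ t, t = a ∨ t = b → ∫ σ in (f t)..c, g (σ + t * Complex.I) =
      H (c + t * Complex.I) - H (curve f t) := fun t ht => by
    have hA : ∀ σ ∈ Icc (f t) c, AnalyticAt ℂ H (σ + t * Complex.I) ∧
        deriv H (σ + t * Complex.I) = g (σ + t * Complex.I) := fun σ hσ =>
      hH _ (Or.inr (by simpa using ⟨ht, hσ⟩))
    have h3 : ∫ σ in (f t)..c, g (σ + t * Complex.I) =
        ∫ σ in (f t)..c, deriv H (σ + t * Complex.I) := by
      refine intervalIntegral.integral_congr fun σ hσ => ?_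
      rw [uIcc_of_le (hfc t)] at hσ
      exact (hA σ hσ).2.symm
    rw [h3]
    refine intervalIntegral.integral_eq_sub_of_hasDerivAt
      (f := fun σ : ℝ => H (σ + t * Complex.I)) (fun σ hσ => ?_) ?_
    · rw [uIcc_of_le (hfc t)] at hσ
      have h2 : HasDerivAt (fun σ : ℝ => (σ : ℂ) + t * Complex.I) 1 σ :=
        ((hasDerivAt_id σ).ofReal_comp).add_const _
      exact ((hA σ hσ).1.differentiableAt.hasDerivAt.comp σ h2).congr_deriv (mul_one _)
    · refine ContinuousOn.intervalIntegrable fun σ hσ => ?_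
      rw [uIcc_of_le (hfc t)] at hσ
      exact ((hA σ hσ).1.deriv.continuousAt.comp (f := fun σ : ℝ => (σ : ℂ) + t * Complex.I)
        (by fun_prop)).continuousWithinAt
  have h2 : Complex.I * ∫ t in a..b, g (c + t * Complex.I) =
      H (c + b * Complex.I) - H (c + a * Complex.I) := by
    have hA : ∀ t ∈ Icc a b, AnalyticAt ℂ H (c + t * Complex.I) ∧
        deriv H (c + t * Complex.I) = g (c + t * Complex.I) := fun t ht =>
      hH _ (Or.inl (by simpa using ht))
    have h3 : ∫ t in a..b, g (c + t * Complex.I) = ∫ t in a..b, deriv H (c + t * Complex.I) := by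
      refine intervalIntegral.integral_congr fun t ht => ?_
      rw [uIcc_of_le hab] at ht
      exact (hA t ht).2.symm
    have := integral_screen_deriv (f := fun _ => c) (K := 0) (LipschitzWith.const c) hab
      (H := H) fun t ht => (hA t ht).1
    rw [h3]
    simpa [curve, intervalIntegral.integral_const_mul] using this
  simp only [straightIntegral]
  rw [h1 a (Or.inl rfl), h1 b (Or.inr rfl), h2]
  ring

theorem straightIntegral_sub_screenIntegral_inv_of_right {w : ℂ} (ha : a < w.im) (hb : w.im < b)
    (hw : f w.im < w.re) (hc : w.re < c) :
    straightIntegral f c a b (fun s => (s - w)⁻¹) - screenIntegral f a b (fun s => (s - w)⁻¹) =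
      2 * Real.pi * Complex.I := by
  have hd1 : ∀ s, s - w ∈ Complex.slitPlane →
      HasDerivAt (fun s => Complex.log (s - w)) (s - w)⁻¹ s := fun s hs => by
    simpa using ((hasDerivAt_id s).sub_const w).clog hs
  have hd2 : ∀ s, w - s ∈ Complex.slitPlane →
      HasDerivAt (fun s => Complex.log (w - s)) (s - w)⁻¹ s := fun s hs => by
    refine (((hasDerivAt_id s).const_sub w).clog hs).congr_deriv ?_
    rw [id, ← neg_sub s w, div_neg, neg_div, neg_neg, one_div]
  have h1 : straightIntegral f c a b (fun s => (s - w)⁻¹) =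
      Complex.log (curve f b - w) - Complex.log (curve f a - w) := by
    have hs : ∀ s, (s.re = c ∧ s.im ∈ Icc a b) ∨
        (s.im = a ∨ s.im = b) ∧ s.re ∈ Icc (f s.im) c → s - w ∈ Complex.slitPlane := by
      rintro s (⟨h, -⟩ | ⟨h | h, -⟩)
      · left
        simp [h, hc]
      · right
        simp only [Complex.sub_im]
        linarith
      · right
        simp only [Complex.sub_im]
        linarith
    exact straightIntegral_eq_sub (H := fun s => Complex.log (s - w)) hab hfc fun s h =>
      ⟨AnalyticAt.clog (by fun_prop) (hs s h), (hd1 s (hs s h)).deriv⟩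
  have h2 : screenIntegral f a b (fun s => (s - w)⁻¹) =
      Complex.log (w - curve f b) - Complex.log (w - curve f a) := by
    have hs : ∀ t ∈ Icc a b, w - curve f t ∈ Complex.slitPlane := by
      intro t ht
      by_cases h : t = w.im
      · left
        simp [h, hw]
      · right
        simpa [sub_eq_zero] using Ne.symm h
    exact screenIntegral_eq_sub (H := fun s => Complex.log (w - s)) hf hab fun s h =>
      ⟨AnalyticAt.clog (by fun_prop) (hs s h), (hd2 _ (hs s h)).deriv⟩
  have hlog : ∀ z : ℂ, 0 < z.im → Complex.log z - Complex.log (-z) = Real.pi * Complex.I := by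
    intro z hz
    rw [Complex.log, Complex.log, norm_neg, Complex.arg_neg_eq_arg_sub_pi_of_im_pos hz]
    push_cast
    ring
  have e1 := hlog (curve f b - w) (by simpa using hb)
  have e2 := hlog (w - curve f a) (by simpa using ha)
  rw [neg_sub] at e1 e2
  rw [h1, h2]
  linear_combination e1 + e2

theorem straightIntegral_sub_screenIntegral_inv_of_left {w : ℂ}
    (hw : w.im ∈ Icc a b → w.re < f w.im) :
    straightIntegral f c a b (fun s => (s - w)⁻¹) - screenIntegral f a b (fun s => (s - w)⁻¹) =
      0 := by
  have hd1 : ∀ s, s - w ∈ Complex.slitPlane → AnalyticAt ℂ (fun s => Complex.log (s - w)) s ∧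
      deriv (fun s => Complex.log (s - w)) s = (s - w)⁻¹ := fun s hs =>
    ⟨AnalyticAt.clog (by fun_prop) hs,
      by simpa using (((hasDerivAt_id s).sub_const w).clog hs).deriv⟩
  have hs : ∀ s : ℂ, s.im ∈ Icc a b → f s.im ≤ s.re → s - w ∈ Complex.slitPlane := by
    intro s h1 h2
    by_cases h : s.im = w.im
    · left
      rw [h] at h1 h2
      simp only [Complex.sub_re]
      linarith [hw h1]
    · right
      simpa [sub_eq_zero] using h
  rw [straightIntegral_eq_sub (H := fun s => Complex.log (s - w)) hab hfc fun s h => hd1 s ?_,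
    screenIntegral_eq_sub (H := fun s => Complex.log (s - w)) hf hab fun t h =>
      hd1 _ (hs _ (by simpa using h) (by simp)), sub_self]
  rcases h with ⟨h1, h2⟩ | ⟨h1 | h1, h2⟩
  · exact hs s h2 (h1 ▸ hfc _)
  · exact hs s (by simp [h1, hab]) h2.1
  · exact hs s (by simp [h1, hab]) h2.1

theorem two_pi_I_mul_sum_residue {F : ℂ → ℂ} (hF : Meromorphic F)
    (hcurve : ∀ t, AnalyticAt ℂ F (curve f t)) (hright : ∀ s : ℂ, c ≤ s.re → AnalyticAt ℂ F s)
    (hhor : ∀ s : ℂ, s.im = a ∨ s.im = b → AnalyticAt ℂ F s) :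
    ∃ P : Finset ℂ, (∀ w, w ∈ P ↔ ¬ AnalyticAt ℂ F w ∧ f w.im ≤ w.re ∧ a < w.im ∧ w.im < b) ∧
      2 * Real.pi * Complex.I * ∑ w ∈ P, residue F w =
        straightIntegral f c a b F - screenIntegral f a b F := by
  obtain ⟨B, hB⟩ := (isCompact_Icc (a := a) (b := b)).exists_bound_of_continuousOn
    hf.continuous.continuousOn
  set r := B + |c| + |a| + |b| + 1 with hr
  have hball : ∀ s : ℂ, s.im ∈ Icc a b → f s.im ≤ s.re → s.re ≤ c → s ∈ Metric.ball (0 : ℂ) r := by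
    intro s h1 h2 h3
    rw [mem_ball_zero_iff]
    have h4 := Complex.norm_le_abs_re_add_abs_im s
    have h5 := hB _ h1
    rw [Real.norm_eq_abs] at h5
    have h6 : |s.re| ≤ B + |c| := by
      rw [abs_le]
      constructor
      · linarith [neg_abs_le (f s.im), abs_nonneg c]
      · linarith [le_abs_self c, abs_nonneg (f s.im)]
    have h7 : |s.im| ≤ |a| + |b| := by
      rw [abs_le]
      constructor
      · linarith [neg_abs_le a, abs_nonneg b, h1.1]
      · linarith [le_abs_self b, abs_nonneg a, h1.2]
    linarith
  obtain ⟨P₀, H, hP1, hP2, hH⟩ := exists_primitive_off_poles hF r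
  have hre : ∀ w ∈ P₀, w.re < c := fun w hw => by
    by_contra h
    exact hP1 w hw (hright w (not_lt.1 h))
  have him : ∀ w ∈ P₀, w.im ≠ a ∧ w.im ≠ b := fun w hw =>
    ⟨fun h => hP1 w hw (hhor w (Or.inl h)), fun h => hP1 w hw (hhor w (Or.inr h))⟩
  have hbd : ∀ s ∈ windowBoundary f c a b, AnalyticAt ℂ F s ∧ s ∈ Metric.ball (0 : ℂ) r := by
    rintro s ⟨⟨h1, h2, h3, h4⟩, h5⟩
    refine ⟨?_, hball s ⟨h1, h2⟩ h3 h4⟩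
    rcases h5 with h | h | h | h
    · exact hhor s (Or.inl h)
    · exact hhor s (Or.inr h)
    · exact hright s h.ge
    · have : s = curve f s.im := by apply Complex.ext <;> simp [h]
      rw [this]
      exact hcurve _
  have hne : ∀ s ∈ windowBoundary f c a b, s ∉ P₀ := fun s hs h => hP1 s h (hbd s hs).1
  have hHbd : ∀ s ∈ windowBoundary f c a b, AnalyticAt ℂ H s := fun s hs =>
    (hH s (hbd s hs).2 (hne s hs)).1
  have hFeq : EqOn F (fun s => deriv H s + ∑ w ∈ P₀, residue F w * (s - w)⁻¹)
      (windowBoundary f c a b) := fun s hs => by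
    simp only [(hH s (hbd s hs).2 (hne s hs)).2, div_eq_mul_inv]
    ring
  have hc0 : ContinuousOn (deriv H) (windowBoundary f c a b) := fun s hs =>
    (hHbd s hs).deriv.continuousAt.continuousWithinAt
  have hcw : ∀ w ∈ P₀, ContinuousOn (fun s => residue F w * (s - w)⁻¹) (windowBoundary f c a b) := by
    intro w hw s hs
    have : s - w ≠ 0 := sub_ne_zero.2 fun h => hne s hs (h ▸ hw)
    exact ContinuousAt.continuousWithinAt (by fun_prop (disch := exact this))
  let J : (ℂ → ℂ) → ℂ := fun g => straightIntegral f c a b g - screenIntegral f a b g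
  have hJadd : ∀ g h : ℂ → ℂ, ContinuousOn g (windowBoundary f c a b) →
      ContinuousOn h (windowBoundary f c a b) → J (fun s => g s + h s) = J g + J h := by
    intro g h hg hh
    simp only [J, straightIntegral_add hab hfc hg hh, screenIntegral_add hf hab hfc hg hh]
    ring
  have hJmul : ∀ (k : ℂ) (g : ℂ → ℂ), J (fun s => k * g s) = k * J g := by
    intro k g
    simp only [J, straightIntegral, screenIntegral, intervalIntegral.integral_const_mul,
      mul_left_comm _ k]
    ring
  have hJsum : ∀ Q ⊆ P₀, J (fun s => ∑ w ∈ Q, residue F w * (s - w)⁻¹) =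
      ∑ w ∈ Q, residue F w * J (fun s => (s - w)⁻¹) := by
    intro Q
    induction Q using Finset.induction_on with
    | empty => intro _; simp [J, straightIntegral, screenIntegral]
    | insert w Q hwQ ih =>
      intro hQ
      rw [Finset.insert_subset_iff] at hQ
      simp only [Finset.sum_insert hwQ]
      rw [hJadd _ _ (hcw w hQ.1) (continuousOn_finsetSum _ fun v hv => hcw v (hQ.2 hv)),
        hJmul, ih hQ.2]
  have hJH : J (deriv H) = 0 := by
    simp only [J]
    rw [straightIntegral_eq_sub (H := H) hab hfc fun s h => ⟨hHbd s ?_, rfl⟩,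
      screenIntegral_eq_sub (H := H) hf hab fun t h =>
        ⟨hHbd _ (curve_mem_windowBoundary hfc h), rfl⟩, sub_self]
    rcases h with ⟨h1, h2⟩ | ⟨h1 | h1, h2⟩
    · exact ⟨⟨h2.1, h2.2, h1 ▸ hfc _, h1.le⟩, by simp [h1]⟩
    · exact ⟨⟨h1.ge, h1.le.trans hab, h2.1, h2.2⟩, by simp [h1]⟩
    · exact ⟨⟨hab.trans h1.ge, h1.le, h2.1, h2.2⟩, by simp [h1]⟩
  have hJF : J F = ∑ w ∈ P₀, residue F w * J (fun s => (s - w)⁻¹) := by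
    have : J F = J (fun s => deriv H s + ∑ w ∈ P₀, residue F w * (s - w)⁻¹) := by
      simp only [J]
      rw [straightIntegral_congr hab hfc hFeq, screenIntegral_congr hab hfc hFeq]
    rw [this, hJadd _ _ hc0 (continuousOn_finsetSum _ hcw), hJH, zero_add, hJsum _ subset_rfl]
  classical
  refine ⟨P₀.filter fun w => f w.im ≤ w.re ∧ a < w.im ∧ w.im < b, fun w => ?_, ?_⟩
  · rw [Finset.mem_filter]
    refine and_congr_left fun h => ⟨hP1 w, fun hw => hP2 w ?_ hw⟩
    refine hball w ⟨h.2.1.le, h.2.2.le⟩ h.1 ?_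
    by_contra hcon
    exact hw (hright w (not_le.1 hcon).le)
  · change _ = J F
    rw [hJF, Finset.sum_filter, Finset.mul_sum]
    refine Finset.sum_congr rfl fun w hw => ?_
    have hwc : curve f w.im ≠ w := fun h => hP1 w hw (h ▸ hcurve _)
    split_ifs with h
    · have hlt : f w.im < w.re := lt_of_le_of_ne h.1 fun heq =>
        hwc (by apply Complex.ext <;> simp [heq])
      simp only [J]
      rw [straightIntegral_sub_screenIntegral_inv_of_right hf hab hfc h.2.1 h.2.2 hlt (hre w hw)]
      ring
    · simp only [J]
      rw [straightIntegral_sub_screenIntegral_inv_of_left hf hab hfc]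
      · simp
      · intro hI
        by_contra hcon
        exact h ⟨not_lt.1 hcon, lt_of_le_of_ne hI.1 (him w hw).1.symm,
          lt_of_le_of_ne hI.2 (him w hw).2⟩

end

/-! ### Mellin transforms of test functions -/

section

variable {φ : ℝ → ℂ} {a b : ℝ}

theorem tsupport_deriv_subset_of_subset (hs : tsupport φ ⊆ Ioo a b) :
    tsupport (deriv φ) ⊆ Ioo a b :=
  (closure_minimal support_deriv_subset isClosed_closure).trans hs

theorem eq_zero_of_notMem_Ioo (hs : tsupport φ ⊆ Ioo a b) {x : ℝ} (hx : x ∉ Ioo a b) : φ x = 0 :=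
  image_eq_zero_of_notMem_tsupport fun h => hx (hs h)

theorem mellin_eq_intervalIntegral (ha : 0 < a) (hab : a ≤ b) (hs : tsupport φ ⊆ Ioo a b) (z : ℂ) :
    mellin φ z = ∫ x in a..b, (x : ℂ) ^ (z - 1) * φ x := by
  rw [mellin, intervalIntegral.integral_of_le hab]
  refine setIntegral_eq_of_subset_of_forall_sdiff_eq_zero measurableSet_Ioi
    (fun x hx => ha.trans hx.1) fun x hx => ?_
  rw [eq_zero_of_notMem_Ioo hs fun h => hx.2 ⟨h.1, h.2.le⟩, smul_zero]

theorem intervalIntegrable_cpow_mul (ha : 0 < a) (hab : a ≤ b) (hφ : Continuous φ) (z : ℂ) :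
    IntervalIntegrable (fun x : ℝ => (x : ℂ) ^ z * φ x) volume a b := by
  refine ContinuousOn.intervalIntegrable fun x hx => ?_
  rw [uIcc_of_le hab] at hx
  have hx0 : 0 < x := ha.trans_le hx.1
  exact ((Complex.continuousAt_ofReal_cpow_const x z (Or.inr hx0.ne')).mul
    hφ.continuousAt).continuousWithinAt

/-- Integration by parts in the Mellin transform. -/
theorem mellin_eq_neg_mellin_deriv (ha : 0 < a) (hab : a ≤ b) (hφ : ContDiff ℝ ∞ φ)
    (hs : tsupport φ ⊆ Ioo a b) {z : ℂ} (hz : z ≠ 0) :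
    z * mellin φ z = - mellin (deriv φ) (z + 1) := by
  rw [mellin_eq_intervalIntegral ha hab hs,
    mellin_eq_intervalIntegral ha hab (tsupport_deriv_subset_of_subset hs), add_sub_cancel_right]
  have hdc : Continuous (deriv φ) := hφ.continuous_deriv (by simp)
  have hparts := intervalIntegral.integral_mul_deriv_eq_deriv_mul (a := a) (b := b)
    (u := fun x : ℝ => (x : ℂ) ^ z) (v := φ) (u' := fun x : ℝ => z * (x : ℂ) ^ (z - 1))
    (v' := deriv φ) (fun x hx => ?_)
    (fun x _ => (hφ.differentiable (by simp) x).hasDerivAt) ?_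
    (hdc.intervalIntegrable a b)
  · rw [hparts, eq_zero_of_notMem_Ioo hs (x := a) (by simp),
      eq_zero_of_notMem_Ioo hs (x := b) (by simp)]
    simp_rw [mul_assoc]
    rw [intervalIntegral.integral_const_mul]
    ring
  · rw [uIcc_of_le hab] at hx
    exact hasDerivAt_ofReal_cpow_const (ha.trans_le hx.1).ne' hz
  · simpa using (intervalIntegrable_cpow_mul ha hab (continuous_const (y := (1 : ℂ)))
      (z - 1)).const_mul z

theorem rpow_le_add_rpow (ha : 0 < a) {x : ℝ} (hx : x ∈ Icc a b) (y : ℝ) :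
    x ^ y ≤ a ^ y + b ^ y := by
  have hx0 := ha.trans_le hx.1
  rcases le_total 0 y with hy | hy
  · exact (Real.rpow_le_rpow hx0.le hx.2 hy).trans
      (le_add_of_nonneg_left (Real.rpow_nonneg ha.le _))
  · exact (Real.rpow_le_rpow_of_nonpos ha hx.1 hy).trans
      (le_add_of_nonneg_right (Real.rpow_nonneg (hx0.le.trans hx.2) _))

/-- Rapid decay of the Mellin transform in vertical directions. -/
theorem exists_norm_mellin_le (ha : 0 < a) (hab : a ≤ b) (N : ℕ) :
    ∀ φ : ℝ → ℂ, ContDiff ℝ ∞ φ → tsupport φ ⊆ Ioo a b → ∃ C : ℝ, 0 ≤ C ∧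
      ∀ z : ℂ, ‖mellin φ z‖ ≤ C * (a ^ z.re + b ^ z.re) / (1 + |z.im|) ^ N := by
  have hb : 0 < b := ha.trans_le hab
  induction N with
  | zero =>
    intro φ hφ hs
    obtain ⟨M, hM⟩ := (isCompact_Icc (a := a) (b := b)).exists_bound_of_continuousOn
      hφ.continuous.continuousOn
    have hM0 : 0 ≤ M := (norm_nonneg _).trans (hM a ⟨le_rfl, hab⟩)
    refine ⟨M / a * (b - a), mul_nonneg (by positivity) (sub_nonneg.2 hab), fun z => ?_⟩
    rw [pow_zero, div_one, mellin_eq_intervalIntegral ha hab hs]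
    refine (intervalIntegral.norm_integral_le_of_norm_le_const
      (C := M / a * (a ^ z.re + b ^ z.re)) fun x hx => ?_).trans_eq ?_
    · rw [uIoc_of_le hab] at hx
      have hx' : x ∈ Icc a b := ⟨hx.1.le, hx.2⟩
      have hx0 : 0 < x := ha.trans hx.1
      rw [norm_mul, Complex.norm_cpow_eq_rpow_re_of_pos hx0, Complex.sub_re, Complex.one_re,
        Real.rpow_sub_one hx0.ne']
      have h1 : x ^ z.re / x ≤ (a ^ z.re + b ^ z.re) / a :=
        div_le_div₀ (by positivity) (rpow_le_add_rpow ha hx' _) ha hx'.1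
      calc x ^ z.re / x * ‖φ x‖ ≤ (a ^ z.re + b ^ z.re) / a * M :=
            mul_le_mul h1 (hM x hx') (norm_nonneg _) (by positivity)
        _ = M / a * (a ^ z.re + b ^ z.re) := by ring
    · rw [abs_of_nonneg (sub_nonneg.2 hab)]
      ring
  | succ N ih =>
    intro φ hφ hs
    obtain ⟨C₀, hC₀, h₀⟩ := ih φ hφ hs
    obtain ⟨C₁, hC₁, h₁⟩ := ih (deriv φ) (contDiff_infty_iff_deriv.1 hφ).2 (tsupport_deriv_subset_of_subset hs)
    refine ⟨2 * C₀ + 2 * b * C₁, by positivity, fun z => ?_⟩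
    set S := a ^ z.re + b ^ z.re with hS
    have hS0 : 0 ≤ S := by positivity
    have hy : 0 < 1 + |z.im| := by positivity
    rcases le_or_gt |z.im| 1 with h | h
    · calc ‖mellin φ z‖ ≤ C₀ * S / (1 + |z.im|) ^ N := h₀ z
        _ = C₀ * S * (1 + |z.im|) / (1 + |z.im|) ^ (N + 1) := by
          field_simp
          ring
        _ ≤ (2 * C₀ + 2 * b * C₁) * S / (1 + |z.im|) ^ (N + 1) := by
          refine div_le_div_of_nonneg_right ?_ (by positivity)
          have h1 : 0 ≤ 2 * b * C₁ * S := by positivity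
          have h2 := mul_le_mul_of_nonneg_left (show 1 + |z.im| ≤ 2 by linarith)
            (mul_nonneg hC₀ hS0)
          linarith
    · have hz1 : (1 + |z.im|) / 2 ≤ ‖z‖ := by linarith [Complex.abs_im_le_norm z]
      have hz : z ≠ 0 := by
        rintro rfl
        simp at h
        linarith
      have h2 : ‖z‖ * ‖mellin φ z‖ ≤ C₁ * (b * S) / (1 + |z.im|) ^ N := by
        rw [← norm_mul, mellin_eq_neg_mellin_deriv ha hab hφ hs hz, norm_neg]
        refine (h₁ (z + 1)).trans ?_
        simp only [Complex.add_re, Complex.one_re, Complex.add_im, Complex.one_im, add_zero]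
        gcongr
        rw [Real.rpow_add_one ha.ne', Real.rpow_add_one hb.ne', hS]
        nlinarith [Real.rpow_nonneg ha.le z.re]
      have h3 : (1 + |z.im|) / 2 * ‖mellin φ z‖ ≤ C₁ * (b * S) / (1 + |z.im|) ^ N :=
        (mul_le_mul_of_nonneg_right hz1 (norm_nonneg _)).trans h2
      have h4 : 0 ≤ C₀ * S := by positivity
      rw [le_div_iff₀ (by positivity)] at h3 ⊢
      calc ‖mellin φ z‖ * (1 + |z.im|) ^ (N + 1)
          = 2 * ((1 + |z.im|) / 2 * ‖mellin φ z‖ * (1 + |z.im|) ^ N) := by ring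
        _ ≤ 2 * (C₁ * (b * S)) := by linarith
        _ ≤ (2 * C₀ + 2 * b * C₁) * S := by nlinarith

theorem differentiable_mellin (ha : 0 < a) (hφ : Continuous φ) (hs : tsupport φ ⊆ Ioo a b) :
    Differentiable ℂ (mellin φ) := by
  intro z
  refine mellin_differentiableAt_of_isBigO_rpow (a := z.re + 1) (b := z.re - 1)
    (hφ.continuousOn.locallyIntegrableOn measurableSet_Ioi) ?_ (by linarith) ?_ (by linarith)
  · refine (Asymptotics.isBigO_zero _ _).congr' ?_ EventuallyEq.rfl
    filter_upwards [eventually_ge_atTop b] with x hx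
    exact (eq_zero_of_notMem_Ioo hs fun h => absurd h.2 (not_lt.2 hx)).symm
  · refine (Asymptotics.isBigO_zero _ _).congr' ?_ EventuallyEq.rfl
    filter_upwards [Ioo_mem_nhdsGT ha] with x hx
    exact (eq_zero_of_notMem_Ioo hs fun h => absurd h.1 (not_lt.2 hx.2.le)).symm

theorem integrable_one_add_abs_pow_inv : Integrable fun t : ℝ => ((1 + |t|) ^ 2)⁻¹ := by
  have := integrable_one_add_norm (E := ℝ) (μ := volume) (r := 2) (by simp)
  refine this.congr (ae_of_all _ fun t => ?_)
  simp only [Real.norm_eq_abs]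
  rw [Real.rpow_neg (by positivity)]
  norm_cast

theorem integrable_mellin_vertical (ha : 0 < a) (hab : a ≤ b) (hφ : ContDiff ℝ ∞ φ)
    (hs : tsupport φ ⊆ Ioo a b) (σ : ℝ) :
    Integrable fun t : ℝ => mellin φ (σ + t * Complex.I) := by
  obtain ⟨C, -, hC⟩ := exists_norm_mellin_le ha hab 2 φ hφ hs
  refine (integrable_one_add_abs_pow_inv.const_mul (C * (a ^ σ + b ^ σ))).mono' ?_
    (ae_of_all _ fun t => ?_)
  · exact ((differentiable_mellin ha hφ.continuous hs).continuous.comp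
      (by fun_prop)).aestronglyMeasurable
  · simpa [div_eq_mul_inv] using hC (σ + t * Complex.I)

theorem mellinConvergent_of_tsupport (ha : 0 < a) (hφ : Continuous φ) (hs : tsupport φ ⊆ Ioo a b)
    (z : ℂ) : MellinConvergent φ z := by
  refine mellinConvergent_of_isBigO_rpow (a := z.re + 1) (b := z.re - 1)
    (hφ.continuousOn.locallyIntegrableOn measurableSet_Ioi) ?_ (by linarith) ?_ (by linarith)
  · refine (Asymptotics.isBigO_zero _ _).congr' ?_ EventuallyEq.rfl
    filter_upwards [eventually_ge_atTop b] with x hx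
    exact (eq_zero_of_notMem_Ioo hs fun h => absurd h.2 (not_lt.2 hx)).symm
  · refine (Asymptotics.isBigO_zero _ _).congr' ?_ EventuallyEq.rfl
    filter_upwards [Ioo_mem_nhdsGT ha] with x hx
    exact (eq_zero_of_notMem_Ioo hs fun h => absurd h.1 (not_lt.2 hx.2.le)).symm

/-- The integral `∫₀^∞ ε^{d-s} φ(ε) dε`. -/
noncomputable def testTransform (d : ℕ) (φ : ℝ → ℂ) (s : ℂ) : ℂ := mellin φ (d + 1 - s)

theorem testTransform_eq (d : ℕ) (φ : ℝ → ℂ) (s : ℂ) :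
    testTransform d φ s = ∫ ε in Ioi (0 : ℝ), (ε : ℂ) ^ ((d : ℂ) - s) * φ ε := by
  simp only [testTransform, mellin, smul_eq_mul]
  ring_nf

theorem differentiable_testTransform (ha : 0 < a) (hφ : Continuous φ) (hs : tsupport φ ⊆ Ioo a b)
    (d : ℕ) : Differentiable ℂ (testTransform d φ) :=
  (differentiable_mellin ha hφ hs).comp (by fun_prop)

theorem testTransform_line (d : ℕ) (φ : ℝ → ℂ) (c t : ℝ) :
    testTransform d φ (c + t * Complex.I) =
      mellin φ (((d + 1 - c : ℝ) : ℂ) + ((-t : ℝ) : ℂ) * Complex.I) := by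
  rw [testTransform]
  congr 1
  push_cast
  ring

theorem integrable_testTransform_line (ha : 0 < a) (hab : a ≤ b) (hφ : ContDiff ℝ ∞ φ)
    (hs : tsupport φ ⊆ Ioo a b) (d : ℕ) (c : ℝ) :
    Integrable fun t : ℝ => testTransform d φ (c + t * Complex.I) := by
  simp_rw [testTransform_line]
  exact (integrable_mellin_vertical ha hab hφ hs _).comp_neg

theorem eq_integral_testTransform (ha : 0 < a) (hab : a ≤ b) (hφ : ContDiff ℝ ∞ φ)
    (hs : tsupport φ ⊆ Ioo a b) (d : ℕ) (c : ℝ) {x : ℝ} (hx : 0 < x) :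
    φ x = (2 * Real.pi : ℂ)⁻¹ *
      ∫ t : ℝ, (x : ℂ) ^ (c + t * Complex.I - d - 1) * testTransform d φ (c + t * Complex.I) := by
  have h := mellinInv_mellin_eq (d + 1 - c) φ hx (mellinConvergent_of_tsupport ha hφ.continuous hs _)
    (integrable_mellin_vertical ha hab hφ hs _) hφ.continuous.continuousAt
  rw [← h, mellinInv, ← integral_neg_eq_self]
  simp_rw [testTransform_line]
  rw [Complex.real_smul]
  congr 1
  · push_cast
    rw [one_div]
  · refine integral_congr_ae (ae_of_all _ fun t => ?_)
    simp only [smul_eq_mul]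
    congr 2
    push_cast
    ring

theorem integral_pow_mul_eq (ha : 0 < a) (hab : a ≤ b) (hφ : ContDiff ℝ ∞ φ)
    (hs : tsupport φ ⊆ Ioo a b) {d k : ℕ} (hk : k ≤ d) {c : ℝ} (hc : k < c) {R : ℝ} (hR : 0 < R) :
    ∫ x in Ioc 0 R, (x : ℂ) ^ (d - k) * φ x = (2 * Real.pi : ℂ)⁻¹ *
      ∫ t : ℝ, testTransform d φ (c + t * Complex.I) *
        ((R : ℂ) ^ (c + t * Complex.I - k) / (c + t * Complex.I - k)) := by
  have hR0 : (R : ℂ) ≠ 0 := by exact_mod_cast hR.ne'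
  let q : ℝ → ℝ → ℂ := fun x t =>
    (x : ℂ) ^ (c + t * Complex.I - k - 1) * testTransform d φ (c + t * Complex.I)
  have hint : Integrable (Function.uncurry q) ((volume.restrict (Ioc 0 R)).prod volume) := by
    have h1 : Integrable (fun x : ℝ => x ^ (c - k - 1)) (volume.restrict (Ioc 0 R)) :=
      (intervalIntegrable_iff_integrableOn_Ioc_of_le hR.le).1
        (intervalIntegral.intervalIntegrable_rpow' (by linarith))
    have h2 := (integrable_testTransform_line ha hab hφ hs d c).norm
    refine (h1.mul_prod h2).mono' ?_ ?_
    · have hm : Measurable fun t : ℝ => testTransform d φ (c + t * Complex.I) :=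
        ((differentiable_testTransform ha hφ.continuous hs d).continuous.comp
          (by fun_prop)).measurable
      have : Measurable (Function.uncurry q) := by
        refine Measurable.mul (Measurable.pow (by fun_prop) (by fun_prop)) (hm.comp measurable_snd)
      exact this.aestronglyMeasurable
    · have hrestr : (volume.restrict (Ioc 0 R)).prod (volume : Measure ℝ) =
          (volume.prod volume).restrict (Ioc 0 R ×ˢ univ) := by
        rw [← Measure.prod_restrict, Measure.restrict_univ]
      rw [hrestr]
      refine ae_restrict_of_forall_mem (measurableSet_Ioc.prod MeasurableSet.univ) fun p hp => ?_
      simp only [Function.uncurry, q]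
      rw [norm_mul, Complex.norm_cpow_eq_rpow_re_of_pos hp.1.1]
      simp
  have hleft : ∀ x ∈ Ioc 0 R, (x : ℂ) ^ (d - k) * φ x = (2 * Real.pi : ℂ)⁻¹ * ∫ t, q x t := by
    intro x hx
    have hx0 : (x : ℂ) ≠ 0 := by exact_mod_cast hx.1.ne'
    rw [eq_integral_testTransform ha hab hφ hs d c hx.1, mul_left_comm, ← integral_const_mul]
    congr 2
    funext t
    simp only [q]
    rw [← mul_assoc, ← Complex.cpow_natCast, ← Complex.cpow_add _ _ hx0, Nat.cast_sub hk]
    congr 2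
    ring
  rw [setIntegral_congr_fun measurableSet_Ioc hleft, integral_const_mul, integral_integral_swap hint]
  congr 2
  funext t
  simp only [q]
  rw [integral_mul_const, mul_comm]
  congr 1
  have hne : (c : ℂ) + t * Complex.I - k ≠ 0 := fun h => by
    have := congrArg Complex.re h
    simp at this
    linarith
  rw [← intervalIntegral.integral_of_le hR.le, integral_cpow (Or.inl (by simp; linarith))]
  rw [sub_add_cancel, Complex.ofReal_zero, Complex.zero_cpow hne, sub_zero]

end

/-! ### Inner tube volumes -/

section

variable {d : ℕ}

theorem infDist_frontier_eq_infDist_compl {A : Set (E d)} (hA : IsOpen A) (hne : A ≠ univ)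
    {x : E d} (hx : x ∈ A) : Metric.infDist x (frontier A) = Metric.infDist x Aᶜ := by
  obtain ⟨y, hy, hxy⟩ := exists_mem_frontier_infDist_compl_eq_dist hx hne
  refine le_antisymm (hxy ▸ Metric.infDist_le_dist_of_mem hy) ?_
  refine Metric.infDist_le_infDist_of_subset ?_ ⟨y, hy⟩
  rw [hA.frontier_eq]
  exact fun z hz => hz.2

theorem ne_univ_of_isBounded (hd : 1 ≤ d) {A : Set (E d)} (hA : Bornology.IsBounded A) :
    A ≠ univ := by
  rintro rfl
  have : Nonempty (Fin d) := ⟨⟨0, hd⟩⟩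
  exact NormedSpace.unbounded_univ ℝ (E d) hA

/-- The inner distance to the boundary of a disjoint union of open sets can be computed in
each of the sets. -/
theorem infDist_frontier_iUnion {ι : Type*} {Ω : ι → Set (E d)} (hΩ : ∀ n, IsOpen (Ω n))
    (hdisj : Pairwise fun m n => Disjoint (Ω m) (Ω n)) (hne : ⋃ n, Ω n ≠ univ) {n : ι} {x : E d}
    (hx : x ∈ Ω n) :
    Metric.infDist x (frontier (⋃ n, Ω n)) = Metric.infDist x (frontier (Ω n)) := by
  have hnen : Ω n ≠ univ := fun h => hne (univ_subset_iff.1 (h ▸ subset_iUnion Ω n))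
  have hfr : frontier (Ω n) ⊆ (⋃ n, Ω n)ᶜ := by
    intro y hy hyU
    obtain ⟨m, hm⟩ := mem_iUnion.1 hyU
    rw [(hΩ n).frontier_eq] at hy
    rcases eq_or_ne m n with rfl | hmn
    · exact hy.2 hm
    · obtain ⟨z, hz1, hz2⟩ := mem_closure_iff.1 hy.1 _ (hΩ m) hm
      exact disjoint_left.1 (hdisj hmn) hz1 hz2
  rw [infDist_frontier_eq_infDist_compl (isOpen_iUnion hΩ) hne (mem_iUnion.2 ⟨n, hx⟩)]
  apply le_antisymm
  · obtain ⟨y, hy, -⟩ := exists_mem_frontier_infDist_compl_eq_dist hx hnen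
    exact Metric.infDist_le_infDist_of_subset hfr ⟨y, hy⟩
  · rw [infDist_frontier_eq_infDist_compl (hΩ n) hnen hx]
    exact Metric.infDist_le_infDist_of_subset (compl_subset_compl.2 (subset_iUnion Ω n))
      (nonempty_compl.2 hne)

theorem measurePreserving_isometryEquiv (e : E d ≃ᵢ E d) :
    MeasurePreserving e (volume : Measure (E d)) volume := by
  have h : (e : E d → E d) = fun x => e.toRealAffineIsometryEquiv.linearIsometryEquiv x + e 0 := by
    funext x
    have := e.toRealAffineIsometryEquiv.map_vadd 0 x
    simpa using this
  rw [h]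
  exact (measurePreserving_add_right volume (e 0)).comp
    e.toRealAffineIsometryEquiv.linearIsometryEquiv.measurePreserving

theorem volume_isometryEquiv_image (e : E d ≃ᵢ E d) (A : Set (E d)) :
    volume (e '' A) = volume A := by
  have h := (measurePreserving_isometryEquiv e).measure_preimage_emb
    e.toHomeomorph.measurableEmbedding (e '' A)
  rw [← h, preimage_image_eq _ e.injective]

theorem tubeVolume_isometryEquiv_image (e : E d ≃ᵢ E d) (A : Set (E d)) (ε : ℝ) :
    tubeVolume (e '' A) ε = tubeVolume A ε := by
  have h : {x ∈ e '' A | Metric.infDist x (frontier (e '' A)) ≤ ε} =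
      e '' {x ∈ A | Metric.infDist x (frontier A) ≤ ε} := by
    have hfr : frontier (e '' A) = e '' frontier A := (e.toHomeomorph.image_frontier A).symm
    ext y
    constructor
    · rintro ⟨⟨x, hx, rfl⟩, hy⟩
      rw [hfr, Metric.infDist_image e.isometry] at hy
      exact ⟨x, ⟨hx, hy⟩, rfl⟩
    · rintro ⟨x, ⟨hx, hy⟩, rfl⟩
      refine ⟨⟨x, hx, rfl⟩, ?_⟩
      rwa [hfr, Metric.infDist_image e.isometry]
  rw [tubeVolume, h, volume_isometryEquiv_image, tubeVolume]

theorem volume_smul_toReal {r : ℝ} (hr : 0 < r) (A : Set (E d)) :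
    (volume (r • A)).toReal = r ^ d * (volume A).toReal := by
  rw [Measure.addHaar_smul, ENNReal.toReal_mul, finrank_euclideanSpace_fin,
    abs_of_pos (pow_pos hr d), ENNReal.toReal_ofReal (pow_pos hr d).le]

theorem tubeVolume_smul {r : ℝ} (hr : 0 < r) (A : Set (E d)) (ε : ℝ) :
    tubeVolume (r • A) ε = r ^ d * tubeVolume A (ε / r) := by
  have hfr : frontier (r • A) = r • frontier A :=
    ((Homeomorph.smulOfNeZero r hr.ne').image_frontier A).symm
  have h : {x ∈ r • A | Metric.infDist x (frontier (r • A)) ≤ ε} =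
      r • {x ∈ A | Metric.infDist x (frontier A) ≤ ε / r} := by
    have hd : ∀ x : E d, Metric.infDist (r • x) (r • frontier A) ≤ ε ↔
        Metric.infDist x (frontier A) ≤ ε / r := fun x => by
      rw [infDist_smul₀ hr.ne', Real.norm_of_nonneg hr.le, le_div_iff₀' hr]
    ext y
    constructor
    · rintro ⟨⟨x, hx, rfl⟩, hy⟩
      exact ⟨x, ⟨hx, (hd x).1 (hfr ▸ hy)⟩, rfl⟩
    · rintro ⟨x, ⟨hx, hy⟩, rfl⟩
      exact ⟨⟨x, hx, rfl⟩, hfr ▸ (hd x).2 hy⟩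
  rw [tubeVolume, h, volume_smul_toReal hr, tubeVolume]

theorem bddAbove_inradius_set (hd : 1 ≤ d) {A : Set (E d)} (hA : Bornology.IsBounded A) :
    BddAbove {ε : ℝ | 0 < ε ∧ ∃ x, Metric.ball x ε ⊆ A} := by
  obtain ⟨R, hR⟩ := hA.exists_norm_le
  have : Nonempty (Fin d) := ⟨⟨0, hd⟩⟩
  refine ⟨R, ?_⟩
  rintro ε ⟨hε, x, hx⟩
  refine le_of_forall_lt fun t ht => ?_
  obtain ⟨v, hv⟩ := exists_norm_eq (E d) (c := (max t 0 + ε) / 2) (by positivity)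
  have hvε : ‖v‖ < ε := by
    rw [hv]
    rcases max_cases t 0 with h | h <;> linarith
  have h1 : ‖x + v‖ ≤ R := hR _ (hx (by simpa using hvε))
  have h2 : ‖x - v‖ ≤ R := hR _ (hx (by simpa [dist_eq_norm] using hvε))
  have h3 : 2 * ‖v‖ ≤ 2 * R := by
    have h4 : ‖(x + v) - (x - v)‖ ≤ ‖x + v‖ + ‖x - v‖ := norm_sub_le _ _
    have h5 : (x + v) - (x - v) = (2 : ℝ) • v := by
      rw [two_smul]
      abel
    rw [h5, norm_smul, Real.norm_of_nonneg zero_le_two] at h4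
    linarith
  have := le_max_left t 0
  have h0 : t < (max t 0 + ε) / 2 := by
    rcases max_cases t 0 with h | h <;> linarith
  linarith

theorem IsGenerator.inradius_pos (hd : 1 ≤ d) {G : Set (E d)} (hG : IsGenerator G) :
    0 < inradius G := by
  obtain ⟨x, hx⟩ := hG.nonempty
  obtain ⟨ε, hε, hb⟩ := Metric.isOpen_iff.1 hG.isOpen x hx
  exact hε.trans_le (le_csSup (bddAbove_inradius_set hd hG.isBounded) ⟨hε, x, hb⟩)

theorem IsGenerator.tubeVolume_of_inradius_le (hd : 1 ≤ d) {G : Set (E d)} (hG : IsGenerator G)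
    {ε : ℝ} (hε : inradius G ≤ ε) : tubeVolume G ε = (volume G).toReal := by
  have h : {x ∈ G | Metric.infDist x (frontier G) ≤ ε} = G := by
    refine sep_eq_self_iff_mem_true.2 fun x hx => ?_
    rw [infDist_frontier_eq_infDist_compl hG.isOpen (ne_univ_of_isBounded hd hG.isBounded) hx]
    refine le_trans ?_ hε
    rcases (Metric.infDist_nonneg (x := x) (s := Gᶜ)).eq_or_lt with h0 | h0
    · rw [← h0]
      exact (hG.inradius_pos hd).le
    · exact le_csSup (bddAbove_inradius_set hd hG.isBounded)
        ⟨h0, x, Metric.ball_infDist_compl_subset⟩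
  rw [tubeVolume, h]

/-- The difference `V(r G, ε) - vol(r G)` for a monophase generator `G` of inradius `g`. -/
noncomputable def tubeDefect (d : ℕ) (g : ℝ) (κ : ℕ → ℝ) (r ε : ℝ) : ℝ :=
  if ε < g * r then ∑ k ∈ Finset.range (d + 1), κ k * r ^ k * ε ^ (d - k) else 0

theorem tubeVolume_smul_sub (hd : 1 ≤ d) {G : Set (E d)} (hG : IsGenerator G) {κ : ℕ → ℝ}
    (hκ : IsMonophase G κ) {r ε : ℝ} (hr : 0 < r) (hε : 0 < ε) :
    tubeVolume (r • G) ε - r ^ d * (volume G).toReal = tubeDefect d (inradius G) κ r ε := by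
  rw [tubeVolume_smul hr, tubeDefect]
  split_ifs with h
  · rw [hκ.tube _ (div_pos hε hr) ((div_lt_iff₀ hr).2 h), Finset.sum_range_succ, hκ.top,
      Finset.mul_sum, Nat.sub_self, pow_zero]
    have : ∀ k ∈ Finset.range d, r ^ d * (κ k * (ε / r) ^ (d - k)) = κ k * r ^ k * ε ^ (d - k) := by
      intro k hk
      have hkd : r ^ d = r ^ k * r ^ (d - k) := by
        rw [← pow_add, Nat.add_sub_cancel' (Finset.mem_range.1 hk).le]
      rw [div_pow, hkd]
      field_simp
    rw [Finset.sum_congr rfl this]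
    ring
  · rw [hG.tubeVolume_of_inradius_le hd ((le_div_iff₀ hr).2 (not_lt.1 h)), sub_self]

theorem monotone_tubeVolume {A : Set (E d)} (hA : volume A ≠ ⊤) : Monotone (tubeVolume A) :=
  fun _ _ h => ENNReal.toReal_mono (measure_ne_top_of_subset (sep_subset _ _) hA)
    (measure_mono fun _ hx => ⟨hx.1, hx.2.trans h⟩)

theorem tubeVolume_nonneg (A : Set (E d)) (ε : ℝ) : 0 ≤ tubeVolume A ε := ENNReal.toReal_nonneg

theorem tubeVolume_le {A : Set (E d)} (hA : volume A ≠ ⊤) (ε : ℝ) :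
    tubeVolume A ε ≤ (volume A).toReal :=
  ENNReal.toReal_mono hA (measure_mono (sep_subset _ _))

theorem abs_tubeDefect_le (hd : 1 ≤ d) {G : Set (E d)} (hG : IsGenerator G) {κ : ℕ → ℝ}
    (hκ : IsMonophase G κ) {r ε : ℝ} (hr : 0 < r) (hε : 0 < ε) :
    |tubeDefect d (inradius G) κ r ε| ≤ r ^ d * (volume G).toReal := by
  rw [← tubeVolume_smul_sub hd hG hκ hr hε, tubeVolume_smul hr, ← mul_sub, abs_mul,
    abs_of_pos (pow_pos hr d)]
  gcongr
  have h1 := tubeVolume_le hG.isBounded.measure_lt_top.ne (ε / r)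
  have h2 := tubeVolume_nonneg G (ε / r)
  rw [abs_le]
  constructor <;> linarith

variable {ι : Type*} [Countable ι] {G T : Set (E d)} {ρ : ι → ℝ} {κ : ℕ → ℝ}

theorem IsFractalSpray.hasSum_volume (hT : IsFractalSpray G ρ T) :
    HasSum (fun n => ρ n ^ d * (volume G).toReal) (volume T).toReal := by
  obtain ⟨Ω, hΩ, he, hdisj, rfl⟩ := hT.tiles
  have hv : ∀ n, ρ n ^ d * (volume G).toReal = (volume (Ω n)).toReal := fun n => by
    obtain ⟨e, hn⟩ := he n
    rw [hn, volume_isometryEquiv_image, volume_smul_toReal (hT.pos n)]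
  simp_rw [hv]
  have hU := measure_iUnion (μ := volume) hdisj fun n => (hΩ n).measurableSet
  have hfin : ∑' n, volume (Ω n) ≠ ⊤ := hU ▸ hT.isBounded.measure_lt_top.ne
  rw [hU, ENNReal.tsum_toReal_eq fun n => ENNReal.ne_top_of_tsum_ne_top hfin n]
  exact (ENNReal.summable_toReal hfin).hasSum

theorem IsFractalSpray.hasSum_tubeVolume (hd : 1 ≤ d) (hT : IsFractalSpray G ρ T)
    (ε : ℝ) : HasSum (fun n => tubeVolume (ρ n • G) ε) (tubeVolume T ε) := by
  have hb := hT.isBounded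
  obtain ⟨Ω, hΩ, he, hdisj, rfl⟩ := hT.tiles
  have hne := ne_univ_of_isBounded hd hb
  have hv : ∀ n, tubeVolume (ρ n • G) ε = tubeVolume (Ω n) ε := fun n => by
    obtain ⟨e, hn⟩ := he n
    rw [hn, tubeVolume_isometryEquiv_image]
  simp_rw [hv]
  have hU : {x ∈ ⋃ n, Ω n | Metric.infDist x (frontier (⋃ n, Ω n)) ≤ ε} =
      ⋃ n, {x ∈ Ω n | Metric.infDist x (frontier (Ω n)) ≤ ε} := by
    ext x
    simp only [mem_ofPred_eq, mem_iUnion]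
    constructor
    · rintro ⟨⟨n, hn⟩, hx⟩
      exact ⟨n, hn, infDist_frontier_iUnion hΩ hdisj hne hn ▸ hx⟩
    · rintro ⟨n, hn, hx⟩
      exact ⟨⟨n, hn⟩, (infDist_frontier_iUnion hΩ hdisj hne hn).symm ▸ hx⟩
  have hm : volume (⋃ n, {x ∈ Ω n | Metric.infDist x (frontier (Ω n)) ≤ ε}) =
      ∑' n, volume {x ∈ Ω n | Metric.infDist x (frontier (Ω n)) ≤ ε} := by
    refine measure_iUnion (fun m n hmn => (hdisj hmn).mono (sep_subset _ _) (sep_subset _ _))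
      fun n => ?_
    exact (hΩ n).measurableSet.inter
      (measurableSet_le (Metric.continuous_infDist_pt _).measurable measurable_const)
  have hfin : ∑' n, volume {x ∈ Ω n | Metric.infDist x (frontier (Ω n)) ≤ ε} ≠ ⊤ := by
    rw [← hm, ← hU]
    exact measure_ne_top_of_subset (sep_subset _ _) hb.measure_lt_top.ne
  rw [tubeVolume, hU, hm, ENNReal.tsum_toReal_eq fun n => ENNReal.ne_top_of_tsum_ne_top hfin n]
  exact (ENNReal.summable_toReal hfin).hasSum

theorem IsFractalSpray.hasSum_tubeDefect (hd : 1 ≤ d) (hG : IsGenerator G) (hκ : IsMonophase G κ)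
    (hT : IsFractalSpray G ρ T) {ε : ℝ} (hε : 0 < ε) :
    HasSum (fun n => tubeDefect d (inradius G) κ (ρ n) ε)
      (tubeVolume T ε - (volume T).toReal) := by
  simp_rw [← tubeVolume_smul_sub hd hG hκ (hT.pos _) hε]
  exact (hT.hasSum_tubeVolume hd ε).sub hT.hasSum_volume

theorem IsGenerator.volume_pos (hG : IsGenerator G) : 0 < (volume G).toReal :=
  ENNReal.toReal_pos (hG.isOpen.measure_pos _ hG.nonempty).ne' hG.isBounded.measure_lt_top.ne

theorem IsFractalSpray.summable_pow (hG : IsGenerator G) (hT : IsFractalSpray G ρ T) :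
    Summable fun n => ρ n ^ d :=
  (summable_mul_right_iff hG.volume_pos.ne').1 hT.hasSum_volume.summable

end

/-! ### Normal forms of meromorphic functions -/

/-- The normal form of a meromorphic function on the plane. -/
noncomputable def normalForm (ζ : ℂ → ℂ) : ℂ → ℂ := toMeromorphicNFOn ζ univ

section

variable {ζ : ℂ → ℂ}

theorem normalForm_eventuallyEq (hζ : Meromorphic ζ) (w : ℂ) :
    normalForm ζ =ᶠ[𝓝[≠] w] ζ :=
  MeromorphicOn.toMeromorphicNFOn_eq_self_on_nhdsNE (fun x _ => hζ x) (mem_univ w)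

theorem meromorphicNFAt_normalForm (ζ : ℂ → ℂ) (w : ℂ) : MeromorphicNFAt (normalForm ζ) w :=
  meromorphicNFOn_toMeromorphicNFOn ζ univ (mem_univ w)

theorem meromorphic_normalForm (ζ : ℂ → ℂ) : Meromorphic (normalForm ζ) := fun w =>
  (meromorphicNFAt_normalForm ζ w).meromorphicAt

theorem analyticAt_normalForm_iff (hζ : Meromorphic ζ) {w : ℂ} :
    AnalyticAt ℂ (normalForm ζ) w ↔ w ∉ scalingDimensions ζ := by
  rw [← (meromorphicNFAt_normalForm ζ w).meromorphicOrderAt_nonneg_iff_analyticAt,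
    meromorphicOrderAt_congr (normalForm_eventuallyEq hζ w)]
  exact not_lt.symm

theorem normalForm_eventuallyEq_nhds (hζ : Meromorphic ζ) {D : ℂ → ℂ} {w : ℂ}
    (hD : AnalyticAt ℂ D w) (h : ζ =ᶠ[𝓝[≠] w] D) : normalForm ζ =ᶠ[𝓝 w] D :=
  ((meromorphicNFAt_normalForm ζ w).eventuallyEq_nhdsNE_iff_eventuallyEq_nhds
    hD.meromorphicNFAt).1 ((normalForm_eventuallyEq hζ w).trans h)

/-- A bound along a filter converging to a point excludes a pole at that point, and persists
there. -/
theorem analyticAt_normalForm_of_norm_le (hζ : Meromorphic ζ) {α : Type*} {l : Filter α} [l.NeBot]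
    {u : α → ℂ} {w : ℂ} (hu : Tendsto u l (𝓝[≠] w)) {b : α → ℝ} {B : ℝ} (hb : Tendsto b l (𝓝 B))
    (h : ∀ᶠ x in l, ‖ζ (u x)‖ ≤ b x) :
    AnalyticAt ℂ (normalForm ζ) w ∧ ‖normalForm ζ w‖ ≤ B := by
  have hA : AnalyticAt ℂ (normalForm ζ) w := by
    rw [analyticAt_normalForm_iff hζ]
    intro hw
    have h1 : Tendsto (fun x => ‖ζ (u x)‖) l atTop :=
      tendsto_norm_atTop_iff_cobounded.2 ((tendsto_cobounded_of_meromorphicOrderAt_neg hw).comp hu)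
    exact not_tendsto_nhds_of_tendsto_atTop (tendsto_atTop_mono' l h h1) B hb
  refine ⟨hA, le_of_tendsto_of_tendsto (((hA.continuousAt.mono_left nhdsWithin_le_nhds).comp
    hu).norm) hb ?_⟩
  filter_upwards [h, hu.eventually (normalForm_eventuallyEq hζ w)] with x h1 h2
  simpa [h2] using h1

end

/-! ### The scaling zeta function of a spray -/

section

variable {ι : Type*} {ρ : ι → ℝ}

theorem hasSum_scalingZeta (hρ : ∀ n, 0 < ρ n) {s : ℂ}
    (hs : IntegrableOn (fun x : ℝ => (x : ℂ) ^ (-s)) (Ioi 0) (scalingMeasure ρ)) :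
    HasSum (fun n => (ρ n : ℂ) ^ s)
      (∫ x in Ioi (0 : ℝ), (x : ℂ) ^ (-s) ∂(scalingMeasure ρ)) := by
  have hr : (scalingMeasure ρ).restrict (Ioi 0) = scalingMeasure ρ := by
    classical
    rw [scalingMeasure, Measure.restrict_sum _ measurableSet_Ioi]
    congr 1
    funext n
    rw [restrict_dirac' measurableSet_Ioi, if_pos (mem_Ioi.2 (one_div_pos.2 (hρ n)))]
  rw [IntegrableOn, hr] at hs
  rw [hr]
  suffices hterm : ∀ n, (ρ n : ℂ) ^ s = ∫ x : ℝ, (x : ℂ) ^ (-s) ∂Measure.dirac (1 / ρ n) by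
    simp_rw [hterm]
    exact hasSum_integral_measure hs
  intro n
  have harg : ((ρ n : ℝ) : ℂ).arg ≠ Real.pi := by
    rw [Complex.arg_ofReal_of_nonneg (hρ n).le]
    exact Real.pi_ne_zero.symm
  rw [integral_dirac, Complex.ofReal_div, Complex.ofReal_one, one_div, Complex.inv_cpow _ _ harg,
    Complex.cpow_neg, inv_inv]

variable {d : ℕ}

theorem le_max_one_tsum_pow (hd : 1 ≤ d) (hρ : ∀ n, 0 < ρ n) (hsum : Summable fun n => ρ n ^ d)
    (n : ι) : ρ n ≤ max 1 (∑' n, ρ n ^ d) := by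
  rcases le_total (ρ n) 1 with h | h
  · exact h.trans (le_max_left _ _)
  · exact ((le_self_pow₀ h (by omega)).trans
      (hsum.le_tsum n fun m _ => pow_nonneg (hρ m).le d)).trans (le_max_right _ _)

theorem norm_cpow_le_of_re_le (hd : 1 ≤ d) (hρ : ∀ n, 0 < ρ n) (hsum : Summable fun n => ρ n ^ d)
    {X : ℝ} {s : ℂ} (h1 : d ≤ s.re) (h2 : s.re ≤ X) (n : ι) :
    ‖(ρ n : ℂ) ^ s‖ ≤ ρ n ^ d * (max 1 (∑' n, ρ n ^ d)) ^ (X - d) := by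
  have hR : 1 ≤ max 1 (∑' n, ρ n ^ d) := le_max_left _ _
  rw [Complex.norm_cpow_eq_rpow_re_of_pos (hρ n)]
  calc ρ n ^ s.re = ρ n ^ d * ρ n ^ (s.re - d) := by
        rw [← Real.rpow_natCast, ← Real.rpow_add (hρ n), add_sub_cancel]
    _ ≤ ρ n ^ d * (max 1 (∑' n, ρ n ^ d)) ^ (s.re - d) := by
        exact mul_le_mul_of_nonneg_left (Real.rpow_le_rpow (hρ n).le
          (le_max_one_tsum_pow hd hρ hsum n) (by linarith)) (pow_nonneg (hρ n).le d)
    _ ≤ _ := by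
        exact mul_le_mul_of_nonneg_left (Real.rpow_le_rpow_of_exponent_le hR (by linarith))
          (pow_nonneg (hρ n).le d)

theorem analyticAt_tsum_cpow (hd : 1 ≤ d) (hρ : ∀ n, 0 < ρ n) (hsum : Summable fun n => ρ n ^ d)
    {s : ℂ} (hs : d < s.re) : AnalyticAt ℂ (fun s => ∑' n, (ρ n : ℂ) ^ s) s := by
  have hU : IsOpen {w : ℂ | d < w.re ∧ w.re < s.re + 1} :=
    (isOpen_lt continuous_const Complex.continuous_re).inter
      (isOpen_lt Complex.continuous_re continuous_const)
  refine DifferentiableOn.analyticAt (s := {w : ℂ | d < w.re ∧ w.re < s.re + 1}) ?_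
    (hU.mem_nhds ⟨hs, by linarith⟩)
  refine Complex.differentiableOn_tsum_of_summable_norm
    (hsum.mul_right ((max 1 (∑' n, ρ n ^ d)) ^ (s.re + 1 - d))) (fun n w _ => ?_) hU
    fun n w hw => norm_cpow_le_of_re_le hd hρ hsum hw.1.le hw.2.le n
  have : (ρ n : ℂ) ≠ 0 := by exact_mod_cast (hρ n).ne'
  exact (DifferentiableAt.const_cpow differentiableAt_id (Or.inl this)).differentiableWithinAt

theorem summable_cpow (hd : 1 ≤ d) (hρ : ∀ n, 0 < ρ n) (hsum : Summable fun n => ρ n ^ d)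
    {s : ℂ} (hs : d ≤ s.re) : Summable fun n => (ρ n : ℂ) ^ s :=
  Summable.of_norm_bounded (hsum.mul_right _)
    fun n => norm_cpow_le_of_re_le hd hρ hsum hs le_rfl n

variable {ζ : ℂ → ℂ}

theorem normalForm_eventuallyEq_tsum (hd : 1 ≤ d) (hρ : ∀ n, 0 < ρ n)
    (hsum : Summable fun n => ρ n ^ d) (hζ : IsScalingZeta (scalingMeasure ρ) ζ) {s : ℂ}
    (hs : d < s.re) : normalForm ζ =ᶠ[𝓝 s] fun s => ∑' n, (ρ n : ℂ) ^ s := by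
  obtain ⟨σ₀, hσ₀⟩ := hζ.eq_integral
  set D : ℂ → ℂ := fun s => ∑' n, (ρ n : ℂ) ^ s with hD
  set U : Set ℂ := {w : ℂ | d < w.re} with hUdef
  have hDA : ∀ w ∈ U, AnalyticAt ℂ D w := fun w hw => analyticAt_tsum_cpow hd hρ hsum hw
  have hmer : MeromorphicOn (ζ - D) U := fun w hw => (hζ.meromorphic w).sub (hDA w hw).meromorphicAt
  have hconn : IsPreconnected U := (convex_halfSpace_re_gt (d : ℝ)).isPreconnected
  set y : ℂ := ((max σ₀ d + 1 : ℝ) : ℂ) with hy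
  have hyre : y.re = max σ₀ d + 1 := Complex.ofReal_re _
  have hyU : y ∈ U := by
    change (d : ℝ) < y.re
    rw [hyre]
    linarith [le_max_right σ₀ (d : ℝ)]
  have hordy : meromorphicOrderAt (ζ - D) y = ⊤ := by
    rw [meromorphicOrderAt_eq_top_iff]
    refine Filter.Eventually.filter_mono nhdsWithin_le_nhds ?_
    have hopen : IsOpen {w : ℂ | σ₀ < w.re} := isOpen_lt continuous_const Complex.continuous_re
    filter_upwards [hopen.mem_nhds (show σ₀ < y.re by
      rw [hyre]; linarith [le_max_left σ₀ (d : ℝ)])] with w hw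
    obtain ⟨h1, h2⟩ := hσ₀ w hw
    simp only [Pi.sub_apply, hD]
    rw [h2, (hasSum_scalingZeta hρ h1).tsum_eq, sub_self]
  have hords : meromorphicOrderAt (ζ - D) s = ⊤ := by
    by_contra h
    exact hmer.meromorphicOrderAt_ne_top_of_isPreconnected hconn (x := s) hs hyU h hordy
  rw [meromorphicOrderAt_eq_top_iff] at hords
  refine normalForm_eventuallyEq_nhds hζ.meromorphic (hDA s hs) ?_
  filter_upwards [hords] with w hw
  exact sub_eq_zero.1 hw

theorem hasSum_normalForm (hd : 1 ≤ d) (hρ : ∀ n, 0 < ρ n)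
    (hsum : Summable fun n => ρ n ^ d) (hζ : IsScalingZeta (scalingMeasure ρ) ζ) {s : ℂ}
    (hs : d < s.re) : HasSum (fun n => (ρ n : ℂ) ^ s) (normalForm ζ s) := by
  rw [(normalForm_eventuallyEq_tsum hd hρ hsum hζ hs).eq_of_nhds]
  exact (summable_cpow hd hρ hsum hs.le).hasSum

theorem analyticAt_normalForm_of_lt_re (hd : 1 ≤ d) (hρ : ∀ n, 0 < ρ n)
    (hsum : Summable fun n => ρ n ^ d) (hζ : IsScalingZeta (scalingMeasure ρ) ζ) {s : ℂ}
    (hs : d < s.re) : AnalyticAt ℂ (normalForm ζ) s :=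
  (analyticAt_tsum_cpow hd hρ hsum hs).congr (normalForm_eventuallyEq_tsum hd hρ hsum hζ hs).symm

/-- The scaling zeta function has no pole at the dimension of the ambient space. -/
theorem normalForm_natCast (hd : 1 ≤ d) (hρ : ∀ n, 0 < ρ n)
    (hsum : Summable fun n => ρ n ^ d) (hζ : IsScalingZeta (scalingMeasure ρ) ζ) :
    AnalyticAt ℂ (normalForm ζ) d ∧ normalForm ζ d = ((∑' n, ρ n ^ d : ℝ) : ℂ) := by
  have hu : Tendsto (fun σ : ℝ => (σ : ℂ)) (𝓝[>] (d : ℝ)) (𝓝[≠] (d : ℂ)) := by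
    refine tendsto_nhdsWithin_iff.2 ⟨?_, ?_⟩
    · have := Complex.continuous_ofReal.tendsto (d : ℝ)
      rw [Complex.ofReal_natCast] at this
      exact this.mono_left nhdsWithin_le_nhds
    · filter_upwards [self_mem_nhdsWithin] with σ hσ h
      have : σ = d := by
        rw [mem_singleton_iff] at h
        exact_mod_cast h
      exact (ne_of_gt hσ) this
  have hlim : Tendsto (fun σ : ℝ => ∑' n, (ρ n : ℂ) ^ (σ : ℂ)) (𝓝[>] (d : ℝ))
      (𝓝 (∑' n, (ρ n : ℂ) ^ (d : ℂ))) := by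
    refine tendsto_tsum_of_dominated_convergence
      (hsum.mul_right ((max 1 (∑' n, ρ n ^ d)) ^ ((d : ℝ) + 1 - d))) (fun n => ?_) ?_
    · have h0 : (ρ n : ℂ) ≠ 0 := by exact_mod_cast (hρ n).ne'
      have hc : Continuous fun s : ℂ => (ρ n : ℂ) ^ s :=
        (differentiable_id.const_cpow (Or.inl h0)).continuous
      exact (hc.tendsto _).comp (hu.mono_right nhdsWithin_le_nhds)
    · filter_upwards [Ioo_mem_nhdsGT (lt_add_one (d : ℝ))] with σ hσ n
      exact norm_cpow_le_of_re_le hd hρ hsum (by simpa using hσ.1.le) (by simpa using hσ.2.le) n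
  have hZ : ∀ᶠ σ : ℝ in 𝓝[>] (d : ℝ), normalForm ζ σ = ∑' n, (ρ n : ℂ) ^ (σ : ℂ) := by
    filter_upwards [self_mem_nhdsWithin] with σ hσ
    exact (normalForm_eventuallyEq_tsum hd hρ hsum hζ (by simpa using hσ)).eq_of_nhds
  have hA : AnalyticAt ℂ (normalForm ζ) d := by
    refine (analyticAt_normalForm_of_norm_le hζ.meromorphic hu hlim.norm ?_).1
    filter_upwards [hZ, hu.eventually (normalForm_eventuallyEq hζ.meromorphic d)] with σ h1 h2
    rw [← h2, h1]
  refine ⟨hA, ?_⟩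
  have h1 := (hA.continuousAt.tendsto.mono_left nhdsWithin_le_nhds).comp hu
  have h2 := tendsto_nhds_unique (h1.congr' hZ) hlim
  rw [h2, Complex.ofReal_tsum]
  simp

end

/-! ### The tubular zeta function -/

/-- The factor `∑_{k=0}^{d} g^{s-k} κ_k / (s-k)` of the tubular zeta function. -/
noncomputable def tubularFactor (d : ℕ) (g : ℝ) (κ : ℕ → ℝ) (s : ℂ) : ℂ :=
  ∑ k ∈ Finset.range (d + 1), (g : ℂ) ^ (s - (k : ℂ)) / (s - (k : ℂ)) * (κ k : ℂ)

/-- The tubular zeta function of the normal form of `ζ`, tested against `φ`. -/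
noncomputable def testedZeta (d : ℕ) (g : ℝ) (κ : ℕ → ℝ) (ζ : ℂ → ℂ) (φ : ℝ → ℂ) (s : ℂ) : ℂ :=
  testTransform d φ s * normalForm ζ s * tubularFactor d g κ s

section

variable {d : ℕ} {g : ℝ} {κ : ℕ → ℝ} {ζ : ℂ → ℂ} {φ : ℝ → ℂ} {a b : ℝ}

theorem action_tubularZeta (d : ℕ) (g : ℝ) (κ : ℕ → ℝ) (ζ : ℂ → ℂ) (φ : ℝ → ℂ) (s : ℂ) :
    action (fun ε => tubularZeta d g κ ζ ε s) φ =
      testTransform d φ s * ζ s * tubularFactor d g κ s := by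
  rw [testTransform_eq, mul_assoc, ← integral_mul_const]
  refine integral_congr_ae (ae_of_all _ fun ε => ?_)
  simp only [tubularZeta, tubularFactor]
  ring

theorem distResidue_tubularZeta (hζ : Meromorphic ζ) (w : ℂ) :
    distResidue (tubularZeta d g κ ζ) w φ = residue (testedZeta d g κ ζ φ) w := by
  refine residue_congr ?_
  filter_upwards [normalForm_eventuallyEq hζ w] with s hs
  rw [action_tubularZeta, testedZeta, hs]

theorem analyticAt_cpow_sub (hg : 0 < g) (k : ℕ) (s : ℂ) :
    AnalyticAt ℂ (fun s : ℂ => (g : ℂ) ^ (s - k)) s := by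
  have h0 : (g : ℂ) ≠ 0 := by exact_mod_cast hg.ne'
  have : Differentiable ℂ fun s : ℂ => (g : ℂ) ^ (s - k) :=
    Differentiable.const_cpow (by fun_prop) (Or.inl h0)
  exact this.analyticAt s

theorem analyticAt_tubularFactor_term (hg : 0 < g) {k : ℕ} {s : ℂ} (hs : s ≠ k) (x : ℝ) :
    AnalyticAt ℂ (fun s : ℂ => (g : ℂ) ^ (s - k) / (s - k) * (x : ℂ)) s :=
  ((analyticAt_cpow_sub hg k s).fun_div (analyticAt_id.sub analyticAt_const)
    (sub_ne_zero.2 hs)).mul analyticAt_const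

theorem meromorphic_testedZeta (hg : 0 < g) (hφ : Differentiable ℂ (testTransform d φ)) :
    Meromorphic (testedZeta d g κ ζ φ) := by
  intro s
  refine ((hφ.analyticAt s).meromorphicAt.mul (meromorphic_normalForm ζ s)).mul ?_
  refine MeromorphicAt.fun_sum fun k _ => ?_
  exact ((analyticAt_cpow_sub hg k s).meromorphicAt.div
    ((analyticAt_id.sub analyticAt_const).meromorphicAt)).mul (MeromorphicAt.const _ _)

theorem analyticAt_testedZeta (hg : 0 < g) (hφ : Differentiable ℂ (testTransform d φ)) {s : ℂ}
    (hζs : AnalyticAt ℂ (normalForm ζ) s) (hs : ∀ k ≤ d, s ≠ k) :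
    AnalyticAt ℂ (testedZeta d g κ ζ φ) s := by
  refine ((hφ.analyticAt s).mul hζs).mul (Finset.analyticAt_fun_sum _ fun k hk => ?_)
  exact analyticAt_tubularFactor_term hg (hs k (Nat.lt_succ_iff.1 (Finset.mem_range.1 hk))) _

theorem residue_testedZeta_natCast (hg : 0 < g) (hφ : Differentiable ℂ (testTransform d φ))
    (hζ : AnalyticAt ℂ (normalForm ζ) d) :
    residue (testedZeta d g κ ζ φ) d = testTransform d φ d * normalForm ζ d * κ d := by
  let Q : ℂ → ℂ := fun s => testTransform d φ s * normalForm ζ s * ((g : ℂ) ^ (s - d) * κ d)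
  let R : ℂ → ℂ := fun s => testTransform d φ s * normalForm ζ s *
    ∑ k ∈ Finset.range d, (g : ℂ) ^ (s - (k : ℂ)) / (s - (k : ℂ)) * (κ k : ℂ)
  have hQ : AnalyticAt ℂ Q d :=
    ((hφ.analyticAt _).mul hζ).mul ((analyticAt_cpow_sub hg d d).mul analyticAt_const)
  have hR : AnalyticAt ℂ R d := by
    refine ((hφ.analyticAt _).mul hζ).mul (Finset.analyticAt_fun_sum _ fun k hk => ?_)
    refine analyticAt_tubularFactor_term hg (fun h => ?_) _
    have : d = k := by exact_mod_cast h
    exact (Finset.mem_range.1 hk).ne' this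
  have hdQ : AnalyticAt ℂ (dslope Q d) d := by
    obtain ⟨p, hp⟩ := hQ
    exact hp.has_fpower_series_dslope_fslope.analyticAt
  obtain ⟨H, hH⟩ := AnalyticAt.exists_primitive (hdQ.add hR)
  have hQd : Q d = testTransform d φ d * normalForm ζ d * κ d := by simp [Q]
  rw [← hQd]
  refine residue_eq (H := H) ?_
  filter_upwards [hH.filter_mono nhdsWithin_le_nhds, self_mem_nhdsWithin] with s hs hsd
  refine hs.congr_deriv ?_
  have h0 : s - d ≠ 0 := sub_ne_zero.2 hsd
  simp only [Pi.add_apply]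
  rw [dslope_of_ne _ hsd, slope_def_field, testedZeta, tubularFactor, Finset.sum_range_succ]
  simp only [Q, R]
  field_simp
  ring

end

/-! ### The tube formula as a vertical integral -/

theorem norm_tubularFactor_le {d : ℕ} {g : ℝ} (hg : 0 < g) (κ : ℕ → ℝ) {s : ℂ}
    (hs : ∀ k ≤ d, 1 ≤ ‖s - k‖) :
    ‖tubularFactor d g κ s‖ ≤ g ^ s.re * ∑ k ∈ Finset.range (d + 1), |κ k| / g ^ k := by
  rw [Finset.mul_sum]
  refine (norm_sum_le _ _).trans (Finset.sum_le_sum fun k hk => ?_)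
  rw [norm_mul, norm_div, Complex.norm_cpow_eq_rpow_re_of_pos hg, Complex.norm_real,
    Real.norm_eq_abs, Complex.sub_re, Complex.natCast_re, Real.rpow_sub_natCast hg.ne']
  have h1 := hs k (Nat.lt_succ_iff.1 (Finset.mem_range.1 hk))
  calc g ^ s.re / g ^ k / ‖s - k‖ * |κ k| ≤ g ^ s.re / g ^ k * |κ k| :=
        mul_le_mul_of_nonneg_right (div_le_self (by positivity) h1) (abs_nonneg _)
    _ = g ^ s.re * (|κ k| / g ^ k) := by ring

section

variable {d : ℕ} {φ : ℝ → ℂ} {a b : ℝ}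

theorem integrable_of_tsupport_subset (hφ : Continuous φ) (hs : tsupport φ ⊆ Ioo a b) :
    Integrable φ :=
  hφ.integrable_of_hasCompactSupport
    ((isCompact_Icc (a := a) (b := b)).of_isClosed_subset (isClosed_tsupport φ)
      (hs.trans Ioo_subset_Icc_self))

theorem measurable_tubeDefect (d : ℕ) (g : ℝ) (κ : ℕ → ℝ) (r : ℝ) :
    Measurable (tubeDefect d g κ r) := by
  unfold tubeDefect
  refine Measurable.ite measurableSet_Iio ?_ measurable_const
  fun_prop

theorem integrable_testTransform_mul_cpow_div (ha : 0 < a) (hab : a ≤ b) (hφ : ContDiff ℝ ∞ φ)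
    (hs : tsupport φ ⊆ Ioo a b) (d : ℕ) {k : ℕ} {c : ℝ} (hc : k < c) {R : ℝ} (hR : 0 < R) :
    Integrable fun t : ℝ => testTransform d φ (c + t * Complex.I) *
      ((R : ℂ) ^ (c + t * Complex.I - k) / (c + t * Complex.I - k)) := by
  have hre : ∀ t : ℝ, ((c : ℂ) + t * Complex.I - k).re = c - k := fun t => by simp
  have hle : ∀ t : ℝ, c - k ≤ ‖(c : ℂ) + t * Complex.I - k‖ := fun t => by
    rw [← hre t]
    exact Complex.re_le_norm _
  have hck : 0 < c - k := sub_pos.2 hc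
  refine (integrable_testTransform_line ha hab hφ hs d c).mul_bdd (c := R ^ (c - k) / (c - k))
    (Continuous.aestronglyMeasurable ?_) (ae_of_all _ fun t => ?_)
  · have hR0 : (R : ℂ) ≠ 0 := by exact_mod_cast hR.ne'
    refine Continuous.div ?_ (by fun_prop) fun t => norm_pos_iff.1 (hck.trans_le (hle t))
    exact (Differentiable.const_cpow (f := fun z : ℂ => z) differentiable_id
        (Or.inl hR0)).continuous.comp (f := fun t : ℝ => (c : ℂ) + t * Complex.I - k) (by fun_prop)
  · rw [norm_div, Complex.norm_cpow_eq_rpow_re_of_pos hR, hre]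
    exact div_le_div_of_nonneg_left (Real.rpow_nonneg hR.le _) hck (hle t)

/-- The contribution of a single copy of the generator. -/
theorem integral_tubeDefect_mul (ha : 0 < a) (hab : a ≤ b) (hφ : ContDiff ℝ ∞ φ)
    (hs : tsupport φ ⊆ Ioo a b) {g : ℝ} (hg : 0 < g) (κ : ℕ → ℝ) {r : ℝ} (hr : 0 < r) {c : ℝ}
    (hc : d < c) :
    ∫ ε in Ioi (0 : ℝ), (tubeDefect d g κ r ε : ℂ) * φ ε = (2 * Real.pi : ℂ)⁻¹ *
      ∫ t : ℝ, testTransform d φ (c + t * Complex.I) * ((r : ℂ) ^ ((c : ℂ) + t * Complex.I) *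
        tubularFactor d g κ (c + t * Complex.I)) := by
  have hR : 0 < g * r := mul_pos hg hr
  have hr0 : (r : ℂ) ≠ 0 := by exact_mod_cast hr.ne'
  have h1 : ∫ ε in Ioi (0 : ℝ), (tubeDefect d g κ r ε : ℂ) * φ ε =
      ∫ ε in Ioo 0 (g * r), ∑ k ∈ Finset.range (d + 1),
        ((κ k : ℂ) * (r : ℂ) ^ k) * ((ε : ℂ) ^ (d - k) * φ ε) := by
    rw [setIntegral_eq_of_subset_of_forall_sdiff_eq_zero (s := Ioo 0 (g * r)) measurableSet_Ioi
      (fun x hx => hx.1)]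
    · refine setIntegral_congr_fun measurableSet_Ioo fun ε hε => ?_
      simp only [tubeDefect, if_pos hε.2]
      push_cast
      rw [Finset.sum_mul]
      exact Finset.sum_congr rfl fun k _ => by ring
    · intro x hx
      have : ¬ x < g * r := fun h => hx.2 ⟨hx.1, h⟩
      simp [tubeDefect, this]
  have hint1 : ∀ k ∈ Finset.range (d + 1), Integrable
      (fun ε : ℝ => ((κ k : ℂ) * (r : ℂ) ^ k) * ((ε : ℂ) ^ (d - k) * φ ε))
      (volume.restrict (Ioo 0 (g * r))) := fun k _ => by
    have hcont : Continuous fun ε : ℝ =>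
        ((κ k : ℂ) * (r : ℂ) ^ k) * ((ε : ℂ) ^ (d - k) * φ ε) := by
      have := hφ.continuous
      fun_prop
    exact (hcont.continuousOn.integrableOn_Icc (a := 0) (b := g * r)).mono_set Ioo_subset_Icc_self
  have hint2 : ∀ k ∈ Finset.range (d + 1), Integrable fun t : ℝ => (κ k : ℂ) * (r : ℂ) ^ k *
      (testTransform d φ (c + t * Complex.I) * (((g * r : ℝ) : ℂ) ^ (c + t * Complex.I - k) /
        (c + t * Complex.I - k))) := fun k hk => by
    have hkd : k ≤ d := Nat.lt_succ_iff.1 (Finset.mem_range.1 hk)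
    have hkc : (k : ℝ) < c := lt_of_le_of_lt (by exact_mod_cast hkd) hc
    exact (integrable_testTransform_mul_cpow_div ha hab hφ hs d hkc hR).const_mul _
  rw [h1, integral_finsetSum _ hint1]
  have h2 : ∀ k ∈ Finset.range (d + 1),
      ∫ ε in Ioo 0 (g * r), ((κ k : ℂ) * (r : ℂ) ^ k) * ((ε : ℂ) ^ (d - k) * φ ε) =
      (2 * Real.pi : ℂ)⁻¹ * ∫ t : ℝ, (κ k : ℂ) * (r : ℂ) ^ k *
      (testTransform d φ (c + t * Complex.I) * (((g * r : ℝ) : ℂ) ^ (c + t * Complex.I - k) /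
        (c + t * Complex.I - k))) := by
    intro k hk
    have hkd : k ≤ d := Nat.lt_succ_iff.1 (Finset.mem_range.1 hk)
    have hkc : (k : ℝ) < c := lt_of_le_of_lt (by exact_mod_cast hkd) hc
    rw [integral_const_mul, integral_const_mul, ← integral_Ioc_eq_integral_Ioo,
      integral_pow_mul_eq ha hab hφ hs hkd hkc hR]
    ring
  rw [Finset.sum_congr rfl h2, ← Finset.mul_sum, ← integral_finsetSum _ hint2]
  congr 2
  funext t
  rw [tubularFactor, Finset.mul_sum, Finset.mul_sum]
  refine Finset.sum_congr rfl fun k _ => ?_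
  rw [Complex.ofReal_mul, Complex.mul_cpow_ofReal_nonneg hg.le hr.le,
    Complex.cpow_sub _ _ hr0, Complex.cpow_natCast]
  have : (r : ℂ) ^ k ≠ 0 := pow_ne_zero _ hr0
  field_simp

variable {ι : Type*} [Countable ι] {G T : Set (E d)} {ρ : ι → ℝ} {κ : ℕ → ℝ} {ζ : ℂ → ℂ}

theorem integral_testedZeta_line (hd : 1 ≤ d) (ha : 0 < a) (hab : a ≤ b) (hφ : ContDiff ℝ ∞ φ)
    (hs : tsupport φ ⊆ Ioo a b) (hG : IsGenerator G) (hκ : IsMonophase G κ)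
    (hT : IsFractalSpray G ρ T) (hζ : IsScalingZeta (scalingMeasure ρ) ζ) :
    Integrable (fun t : ℝ => testedZeta d (inradius G) κ ζ φ (((d + 1 : ℝ) : ℂ) + t * Complex.I)) ∧
    ∫ t : ℝ, testedZeta d (inradius G) κ ζ φ (((d + 1 : ℝ) : ℂ) + t * Complex.I) =
      2 * Real.pi * ∫ ε in Ioi (0 : ℝ), ((tubeVolume T ε - (volume T).toReal : ℝ) : ℂ) * φ ε := by
  set g := inradius G with hgdef
  have hg : 0 < g := hG.inradius_pos hd
  set c : ℝ := d + 1 with hcdef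
  have hc : (d : ℝ) < c := lt_add_one _
  have hsum := hT.summable_pow hG
  have hφi := integrable_of_tsupport_subset hφ.continuous hs
  have hmeas : ∀ r, Measurable fun ε : ℝ => (tubeDefect d g κ r ε : ℂ) := fun r =>
    Complex.measurable_ofReal.comp (measurable_tubeDefect d g κ r)
  have hbound : ∀ n, ∀ᵐ ε ∂(volume.restrict (Ioi (0 : ℝ))),
      ‖(tubeDefect d g κ (ρ n) ε : ℂ)‖ ≤ ρ n ^ d * (volume G).toReal := fun n => by
    filter_upwards [ae_restrict_mem measurableSet_Ioi] with ε hε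
    rw [Complex.norm_real, Real.norm_eq_abs]
    exact abs_tubeDefect_le hd hG hκ (hT.pos n) hε
  have hint : ∀ n, Integrable (fun ε : ℝ => (tubeDefect d g κ (ρ n) ε : ℂ) * φ ε)
      (volume.restrict (Ioi (0 : ℝ))) := fun n =>
    hφi.integrableOn.bdd_mul (hmeas _).aestronglyMeasurable (hbound n)
  have hleft := hasSum_integral_of_summable_integral_norm hint (by
    refine Summable.of_nonneg_of_le (fun n => integral_nonneg fun _ => norm_nonneg _) (fun n => ?_)
      ((hsum.mul_right (volume G).toReal).mul_right (∫ ε in Ioi (0 : ℝ), ‖φ ε‖))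
    rw [← integral_const_mul]
    refine integral_mono_ae (hint n).norm (hφi.integrableOn.norm.const_mul _) ?_
    filter_upwards [hbound n] with ε hε
    rw [norm_mul]
    exact mul_le_mul_of_nonneg_right hε (norm_nonneg _))
  have hleft_eq : ∫ ε in Ioi (0 : ℝ), ∑' n, (tubeDefect d g κ (ρ n) ε : ℂ) * φ ε =
      ∫ ε in Ioi (0 : ℝ), ((tubeVolume T ε - (volume T).toReal : ℝ) : ℂ) * φ ε := by
    refine setIntegral_congr_fun measurableSet_Ioi fun ε hε => ?_
    rw [tsum_mul_right, ← Complex.ofReal_tsum, (hT.hasSum_tubeDefect hd hG hκ hε).tsum_eq]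
  set B : ℝ := g ^ c * ∑ k ∈ Finset.range (d + 1), |κ k| / g ^ k with hB
  have hre : ∀ t : ℝ, ((c : ℂ) + t * Complex.I).re = c := fun t => by simp
  have hne : ∀ t : ℝ, ∀ k ≤ d, 1 ≤ ‖(c : ℂ) + t * Complex.I - k‖ := fun t k hk => by
    refine le_trans ?_ (Complex.re_le_norm _)
    have : (k : ℝ) ≤ d := by exact_mod_cast hk
    rw [Complex.sub_re, hre, Complex.natCast_re]
    linarith
  have hfac : ∀ t : ℝ, ‖tubularFactor d g κ ((c : ℂ) + t * Complex.I)‖ ≤ B := fun t => by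
    have := norm_tubularFactor_le hg κ (hne t)
    rwa [hre] at this
  have hline : Continuous fun t : ℝ => (c : ℂ) + t * Complex.I := by fun_prop
  have hfacc : Continuous fun t : ℝ => tubularFactor d g κ ((c : ℂ) + t * Complex.I) := by
    refine continuous_finsetSum _ fun k hk => continuous_iff_continuousAt.2 fun t => ?_
    refine ContinuousAt.comp (f := fun t : ℝ => (c : ℂ) + t * Complex.I)
      (analyticAt_tubularFactor_term hg ?_ _).continuousAt hline.continuousAt
    intro h
    have := hne t k (Nat.lt_succ_iff.1 (Finset.mem_range.1 hk))
    rw [h, sub_self, norm_zero] at this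
    linarith
  have htt := integrable_testTransform_line ha hab hφ hs d c
  have hint2 : ∀ n, Integrable fun t : ℝ => testTransform d φ (c + t * Complex.I) *
      ((ρ n : ℂ) ^ ((c : ℂ) + t * Complex.I) * tubularFactor d g κ (c + t * Complex.I)) := fun n => by
    have h0 : (ρ n : ℂ) ≠ 0 := by exact_mod_cast (hT.pos n).ne'
    have hcp : Continuous fun t : ℝ => (ρ n : ℂ) ^ ((c : ℂ) + t * Complex.I) :=
      (Differentiable.const_cpow (f := fun z : ℂ => z) differentiable_id
        (Or.inl h0)).continuous.comp hline
    refine htt.mul_bdd (c := ρ n ^ c * B) (hcp.mul hfacc).aestronglyMeasurable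
      (ae_of_all _ fun t => ?_)
    rw [norm_mul, Complex.norm_cpow_eq_rpow_re_of_pos (hT.pos n), hre]
    exact mul_le_mul_of_nonneg_left (hfac t) (Real.rpow_nonneg (hT.pos n).le _)
  have hsumc : Summable fun n => ρ n ^ c := by
    have h := (summable_cpow (s := (c : ℂ)) hd hT.pos hsum (by simpa using hc.le)).norm
    refine h.congr fun n => ?_
    rw [Complex.norm_cpow_eq_rpow_re_of_pos (hT.pos n), Complex.ofReal_re]
  have hnormle : ∀ n (t : ℝ), ‖testTransform d φ (c + t * Complex.I) *
      ((ρ n : ℂ) ^ ((c : ℂ) + t * Complex.I) * tubularFactor d g κ (c + t * Complex.I))‖ ≤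
      ρ n ^ c * B * ‖testTransform d φ (c + t * Complex.I)‖ := fun n t => by
    rw [norm_mul, norm_mul, Complex.norm_cpow_eq_rpow_re_of_pos (hT.pos n), hre, mul_comm]
    exact mul_le_mul_of_nonneg_right (mul_le_mul_of_nonneg_left (hfac t)
      (Real.rpow_nonneg (hT.pos n).le _)) (norm_nonneg _)
  have hright := hasSum_integral_of_summable_integral_norm hint2 (by
    refine Summable.of_nonneg_of_le (fun n => integral_nonneg fun _ => norm_nonneg _) (fun n => ?_)
      ((hsumc.mul_right B).mul_right (∫ t : ℝ, ‖testTransform d φ (c + t * Complex.I)‖))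
    rw [← integral_const_mul]
    exact integral_mono (hint2 n).norm (htt.norm.const_mul _) (hnormle n))
  have hZ : ∀ t : ℝ, ∑' n, testTransform d φ (c + t * Complex.I) *
      ((ρ n : ℂ) ^ ((c : ℂ) + t * Complex.I) * tubularFactor d g κ (c + t * Complex.I)) =
      testedZeta d g κ ζ φ (c + t * Complex.I) := fun t => by
    rw [tsum_mul_left, tsum_mul_right,
      (hasSum_normalForm hd hT.pos hsum hζ (by rw [hre]; exact hc)).tsum_eq, testedZeta, mul_assoc]
  simp_rw [hZ] at hright
  have hpi : (2 * Real.pi : ℂ) ≠ 0 := by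
    have : (Real.pi : ℂ) ≠ 0 := by exact_mod_cast Real.pi_ne_zero
    exact mul_ne_zero two_ne_zero this
  constructor
  · have hZc : Continuous fun t : ℝ => normalForm ζ ((c : ℂ) + t * Complex.I) :=
      continuous_iff_continuousAt.2 fun t => ContinuousAt.comp
        (f := fun t : ℝ => (c : ℂ) + t * Complex.I)
        (analyticAt_normalForm_of_lt_re hd hT.pos hsum hζ (by rw [hre]; exact hc)).continuousAt
        hline.continuousAt
    simp_rw [testedZeta, mul_assoc]
    refine htt.mul_bdd (c := (∑' n, ρ n ^ c) * B) (hZc.mul hfacc).aestronglyMeasurable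
      (ae_of_all _ fun t => ?_)
    have hnorm : ∀ n, ‖(ρ n : ℂ) ^ ((c : ℂ) + t * Complex.I)‖ = ρ n ^ c := fun n => by
      rw [Complex.norm_cpow_eq_rpow_re_of_pos (hT.pos n), hre]
    rw [norm_mul]
    refine mul_le_mul ?_ (hfac t) (norm_nonneg _)
      (tsum_nonneg fun n => Real.rpow_nonneg (hT.pos n).le _)
    rw [← (hasSum_normalForm hd hT.pos hsum hζ (by rw [hre]; exact hc)).tsum_eq]
    refine (norm_tsum_le_tsum_norm (hsumc.congr fun n => (hnorm n).symm)).trans_eq ?_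
    exact tsum_congr hnorm
  · rw [hleft_eq] at hleft
    simp_rw [integral_tubeDefect_mul ha hab hφ hs hg κ (hT.pos _) hc] at hleft
    rw [hleft.unique (hright.mul_left _), mul_inv_cancel_left₀ hpi]

end

/-! ### Estimates on the boundary of the windows -/

theorem rpow_div_pow_ceil_add_le {x : ℝ} (hx : 1 ≤ x) (M : ℝ) (j : ℕ) :
    x ^ M / x ^ (⌈M⌉₊ + j) ≤ (x ^ j)⁻¹ := by
  have hx0 : 0 < x := by linarith
  rw [pow_add, ← div_div, ← one_div]
  refine div_le_div_of_nonneg_right ?_ (by positivity)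
  rw [div_le_one (by positivity), ← Real.rpow_natCast]
  exact Real.rpow_le_rpow_of_exponent_le hx (Nat.le_ceil M)

section

variable {d : ℕ} {g : ℝ} {κ : ℕ → ℝ} {ζ : ℂ → ℂ} {φ : ℝ → ℂ} {a b : ℝ}

theorem exists_norm_testTransform_le (ha : 0 < a) (hab : a ≤ b) (hφ : ContDiff ℝ ∞ φ)
    (hs : tsupport φ ⊆ Ioo a b) (d N : ℕ) : ∃ C : ℝ, 0 ≤ C ∧ ∀ s : ℂ,
      ‖testTransform d φ s‖ ≤
        C * (a ^ ((d : ℝ) + 1 - s.re) + b ^ ((d : ℝ) + 1 - s.re)) / (1 + |s.im|) ^ N := by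
  obtain ⟨C, hC, h⟩ := exists_norm_mellin_le ha hab N φ hφ hs
  exact ⟨C, hC, fun s => by simpa [testTransform] using h (d + 1 - s)⟩

theorem tendsto_integral_horizontal (hg : 0 < g) (ha : 0 < a) (hab : a ≤ b)
    (hφ : ContDiff ℝ ∞ φ) (hs : tsupport φ ⊆ Ioo a b) {y x : ℕ → ℝ}
    (hy : Tendsto (fun n => |y n|) atTop atTop) {c C : ℝ} (hx : ∀ n, |x n| ≤ C)
    (hxc : ∀ n, x n ≤ c) {K M : ℝ} (hK : 0 ≤ K)
    (hζ : ∀ n σ, x n ≤ σ → ‖normalForm ζ (σ + y n * Complex.I)‖ ≤ K * (|y n| + 1) ^ M) :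
    Tendsto (fun n => ∫ σ in (x n)..c, testedZeta d g κ ζ φ (σ + y n * Complex.I)) atTop
      (𝓝 0) := by
  have hb : 0 < b := ha.trans_le hab
  obtain ⟨D, hD, hDle⟩ := exists_norm_testTransform_le ha hab hφ hs d (⌈M⌉₊ + 1)
  obtain ⟨S₁, hS₁⟩ := (isCompact_Icc (a := -C) (b := c)).exists_bound_of_continuousOn
    (f := fun σ : ℝ => a ^ ((d : ℝ) + 1 - σ) + b ^ ((d : ℝ) + 1 - σ)) (by
      refine Continuous.continuousOn ?_
      exact (Continuous.rpow continuous_const (by fun_prop) fun _ => Or.inl ha.ne').add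
        (Continuous.rpow continuous_const (by fun_prop) fun _ => Or.inl hb.ne'))
  obtain ⟨S₂, hS₂⟩ := (isCompact_Icc (a := -C) (b := c)).exists_bound_of_continuousOn
    (f := fun σ : ℝ => g ^ σ * ∑ k ∈ Finset.range (d + 1), |κ k| / g ^ k) (by
      refine Continuous.continuousOn ?_
      exact (Continuous.rpow continuous_const continuous_id fun _ => Or.inl hg.ne').mul
        continuous_const)
  have hbound : ∀ᶠ n in atTop, ‖∫ σ in (x n)..c, testedZeta d g κ ζ φ (σ + y n * Complex.I)‖ ≤
      D * S₁ * K * S₂ * (c + C) * (1 + |y n|)⁻¹ := by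
    filter_upwards [hy.eventually_ge_atTop 1] with n hn
    have hx1 : -C ≤ x n := (abs_le.1 (hx n)).1
    have hS₁0 : 0 ≤ S₁ := (norm_nonneg _).trans (hS₁ (x n) ⟨hx1, hxc n⟩)
    have hS₂0 : 0 ≤ S₂ := (norm_nonneg _).trans (hS₂ (x n) ⟨hx1, hxc n⟩)
    have hy0 : 0 < 1 + |y n| := by positivity
    refine (intervalIntegral.norm_integral_le_of_norm_le_const
      (C := D * S₁ * K * S₂ * (1 + |y n|)⁻¹) fun σ hσ => ?_).trans ?_
    · rw [uIoc_of_le (hxc n)] at hσ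
      have hσ' : σ ∈ Icc (-C) c := ⟨hx1.trans hσ.1.le, hσ.2⟩
      have hre : ((σ : ℂ) + y n * Complex.I).re = σ := by simp
      have him : ((σ : ℂ) + y n * Complex.I).im = y n := by simp
      have h1 : ‖testTransform d φ (σ + y n * Complex.I)‖ ≤
          D * S₁ / (1 + |y n|) ^ (⌈M⌉₊ + 1) := by
        refine (hDle _).trans ?_
        rw [hre, him]
        refine div_le_div_of_nonneg_right ?_ (by positivity)
        exact mul_le_mul_of_nonneg_left ((le_abs_self _).trans (hS₁ σ hσ')) hD
      have h2 := hζ n σ hσ.1.le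
      have h3 : ‖tubularFactor d g κ (σ + y n * Complex.I)‖ ≤ S₂ := by
        refine (norm_tubularFactor_le hg κ fun k _ => ?_).trans ?_
        · refine hn.trans ?_
          have := Complex.abs_im_le_norm ((σ : ℂ) + y n * Complex.I - k)
          rwa [Complex.sub_im, him, Complex.natCast_im, sub_zero] at this
        · rw [hre]
          exact (le_abs_self _).trans (hS₂ σ hσ')
      rw [testedZeta, norm_mul, norm_mul]
      calc _ ≤ D * S₁ / (1 + |y n|) ^ (⌈M⌉₊ + 1) * (K * (|y n| + 1) ^ M) * S₂ := by gcongr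
        _ = D * S₁ * K * S₂ * ((1 + |y n|) ^ M / (1 + |y n|) ^ (⌈M⌉₊ + 1)) := by
          rw [add_comm |y n| 1]
          ring
        _ ≤ D * S₁ * K * S₂ * ((1 + |y n|) ^ 1)⁻¹ := by
          refine mul_le_mul_of_nonneg_left (rpow_div_pow_ceil_add_le ?_ M 1) (by positivity)
          linarith
        _ = _ := by rw [pow_one]
    · rw [abs_of_nonneg (sub_nonneg.2 (hxc n))]
      have h4 : c - x n ≤ c + C := by linarith
      calc _ ≤ D * S₁ * K * S₂ * (1 + |y n|)⁻¹ * (c + C) := by gcongr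
        _ = _ := by ring
  refine squeeze_zero_norm' hbound ?_
  have h0 : Tendsto (fun n => (1 + |y n|)⁻¹) atTop (𝓝 0) :=
    tendsto_inv_atTop_zero.comp (tendsto_atTop_add_const_left _ _ hy)
  simpa using h0.const_mul (D * S₁ * K * S₂ * (c + C))

/-- On a screen to the left of `-p`, the tested tubular zeta function is of the order of
`(A b / g) ^ p`. -/
theorem exists_norm_testedZeta_curve_le (hg : 0 < g) (ha : 0 < a) (hab : a ≤ b)
    (hφ : ContDiff ℝ ∞ φ) (hs : tsupport φ ⊆ Ioo a b) {A : ℝ} (hA : 0 < A) (hbA : b < g / A)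
    (κ : ℕ → ℝ) (d : ℕ) {K : ℝ} (hK : 0 ≤ K) (M : ℝ) :
    ∃ B : ℝ, 0 ≤ B ∧ ∀ (f : ℝ → ℝ) (p : ℝ), 1 ≤ p → (∀ t, f t ≤ -p) →
      (∀ t, ‖normalForm ζ (curve f t)‖ ≤ K * A ^ |f t| * (|t| + 1) ^ M) →
      ∀ t, ‖testedZeta d g κ ζ φ (curve f t)‖ ≤ B * (A * b / g) ^ p * ((1 + |t|) ^ 2)⁻¹ := by
  have hb : 0 < b := ha.trans_le hab
  obtain ⟨D, hD, hDle⟩ := exists_norm_testTransform_le ha hab hφ hs d (⌈M⌉₊ + 2)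
  set S := ∑ k ∈ Finset.range (d + 1), |κ k| / g ^ k with hS
  have hS0 : 0 ≤ S := Finset.sum_nonneg fun k _ => by positivity
  have hq0 : 0 < A * b / g := by positivity
  have hq1 : A * b / g ≤ 1 := by
    rw [div_le_one hg, mul_comm]
    exact ((lt_div_iff₀ hA).1 hbA).le
  refine ⟨2 * D * b ^ (d + 1) * K * S, by positivity, fun f p hp hf hζ t => ?_⟩
  have hft := hf t
  set x := |f t| with hx
  have hfx : f t = -x := by rw [hx, abs_of_neg (by linarith), neg_neg]
  have hxp : p ≤ x := by linarith
  have hx0 : 0 ≤ x := by linarith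
  have h1 : ‖testTransform d φ (curve f t)‖ ≤
      2 * D * b ^ (d + 1) * b ^ x / (1 + |t|) ^ (⌈M⌉₊ + 2) := by
    refine (hDle _).trans ?_
    rw [curve_re, curve_im, hfx, sub_neg_eq_add]
    refine div_le_div_of_nonneg_right ?_ (by positivity)
    have h4 : a ^ ((d : ℝ) + 1 + x) ≤ b ^ ((d : ℝ) + 1 + x) :=
      Real.rpow_le_rpow ha.le hab (by positivity)
    have h5 : b ^ ((d : ℝ) + 1 + x) = b ^ (d + 1) * b ^ x := by
      rw [Real.rpow_add hb]
      congr 1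
      exact_mod_cast Real.rpow_natCast b (d + 1)
    calc _ ≤ D * (b ^ ((d : ℝ) + 1 + x) + b ^ ((d : ℝ) + 1 + x)) := by gcongr
      _ = _ := by
        rw [h5]
        ring
  have h3 : ‖tubularFactor d g κ (curve f t)‖ ≤ (g ^ x)⁻¹ * S := by
    refine (norm_tubularFactor_le hg κ fun k _ => ?_).trans_eq ?_
    · have h6 := Complex.abs_re_le_norm (curve f t - k)
      rw [Complex.sub_re, curve_re, Complex.natCast_re, hfx, abs_of_nonpos (by
        have : (0 : ℝ) ≤ k := k.cast_nonneg
        linarith)] at h6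
      have : (0 : ℝ) ≤ k := k.cast_nonneg
      linarith
    · rw [curve_re, hfx, Real.rpow_neg hg.le]
  have hqx : A ^ x * b ^ x * (g ^ x)⁻¹ ≤ (A * b / g) ^ p := by
    rw [← Real.mul_rpow hA.le hb.le, ← div_eq_mul_inv, ← Real.div_rpow (by positivity) hg.le]
    exact Real.rpow_le_rpow_of_exponent_ge hq0 hq1 hxp
  rw [testedZeta, norm_mul, norm_mul]
  calc _ ≤ 2 * D * b ^ (d + 1) * b ^ x / (1 + |t|) ^ (⌈M⌉₊ + 2) *
        (K * A ^ x * (|t| + 1) ^ M) * ((g ^ x)⁻¹ * S) := by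
        gcongr
        exact hζ t
    _ = 2 * D * b ^ (d + 1) * K * S * (A ^ x * b ^ x * (g ^ x)⁻¹) *
        ((1 + |t|) ^ M / (1 + |t|) ^ (⌈M⌉₊ + 2)) := by
        rw [add_comm |t| 1]
        ring
    _ ≤ 2 * D * b ^ (d + 1) * K * S * (A * b / g) ^ p * ((1 + |t|) ^ 2)⁻¹ := by
        gcongr
        exact rpow_div_pow_ceil_add_le (by linarith [abs_nonneg t]) M 2

end

/-- The screen integrals converge, and the limit inherits bounds of the integrand. -/
theorem tendsto_screenIntegral {f : ℝ → ℝ} {K : ℝ≥0} (hf : LipschitzWith K f) {F : ℂ → ℂ}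
    (hF : ∀ t, AnalyticAt ℂ F (curve f t)) {B : ℝ}
    (hB : ∀ t, ‖F (curve f t)‖ ≤ B * ((1 + |t|) ^ 2)⁻¹) {u v : ℕ → ℝ} (hu : Tendsto u atTop atBot)
    (hv : Tendsto v atTop atTop) : ∃ J : ℂ,
      Tendsto (fun n => screenIntegral f (u n) (v n) F) atTop (𝓝 J) ∧
      ‖J‖ ≤ (K + 1) * B * ∫ t : ℝ, ((1 + |t|) ^ 2)⁻¹ := by
  have hle : ∀ t, ‖(((deriv f t : ℝ) : ℂ) + Complex.I) * F (curve f t)‖ ≤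
      (K + 1) * B * ((1 + |t|) ^ 2)⁻¹ := fun t => by
    rw [norm_mul, mul_assoc]
    refine mul_le_mul ?_ (hB t) (norm_nonneg _) (by positivity)
    refine (norm_add_le _ _).trans ?_
    rw [Complex.norm_I, Complex.norm_real]
    exact add_le_add_left (norm_deriv_le_of_lipschitz hf) 1
  have hdom := integrable_one_add_abs_pow_inv.const_mul ((K + 1) * B)
  have hint : Integrable fun t => (((deriv f t : ℝ) : ℂ) + Complex.I) * F (curve f t) := by
    refine hdom.mono' ?_ (ae_of_all _ hle)
    have hc : Continuous fun t => F (curve f t) := continuous_iff_continuousAt.2 fun t =>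
      (hF t).continuousAt.comp (continuous_curve hf).continuousAt
    exact (((Complex.measurable_ofReal.comp (measurable_deriv f)).add_const _).mul
      hc.measurable).aestronglyMeasurable
  refine ⟨_, intervalIntegral_tendsto_integral hint hu hv, ?_⟩
  rw [← integral_const_mul]
  exact norm_integral_le_of_norm_le hdom (ae_of_all _ hle)

theorem exists_Ioo_of_isTestFunction {φ : ℝ → ℂ} {R : ℝ} (hR : 0 < R)
    (hφ : IsTestFunction (Ioo 0 R) φ) :
    ∃ a b : ℝ, 0 < a ∧ a ≤ b ∧ b < R ∧ tsupport φ ⊆ Ioo a b := by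
  have hc : IsCompact (tsupport φ) := hφ.compact
  rcases (tsupport φ).eq_empty_or_nonempty with h | h
  · exact ⟨R / 2, R / 2, by linarith, le_rfl, by linarith, by simp [h]⟩
  · obtain ⟨x, hx, hxm⟩ := hc.exists_isLeast h
    obtain ⟨y, hy, hym⟩ := hc.exists_isGreatest h
    have hx0 := hφ.support_subset hx
    have hy0 := hφ.support_subset hy
    have hxy := hxm hy
    refine ⟨x / 2, (y + R) / 2, by linarith [hx0.1], by linarith [hx0.1, hy0.2],
      by linarith [hy0.2], fun z hz => ⟨?_, ?_⟩⟩
    · linarith [hxm hz, hx0.1]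
    · linarith [hym hz, hy0.2]

/-! ### Strongly languid zeta functions -/

theorem tendsto_nhdsGT_nhdsNE {u : ℝ → ℂ} (hc : Continuous u) (hi : Function.Injective u) (x : ℝ) :
    Tendsto u (𝓝[>] x) (𝓝[≠] (u x)) := by
  refine tendsto_nhdsWithin_iff.2 ⟨(hc.tendsto x).mono_left nhdsWithin_le_nhds, ?_⟩
  filter_upwards [self_mem_nhdsWithin] with y hy h
  exact (ne_of_gt hy) (hi h)

section

variable {ζ : ℂ → ℂ} {τ : ℤ → ℝ} {f : ℕ → ℝ → ℝ} {A : ℝ}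

theorem LanguidL1.normalForm (hζ : Meromorphic ζ) {f : ℝ → ℝ} (h : LanguidL1 ζ τ f) :
    ∃ M c : ℝ, 0 < c ∧ ∀ n : ℤ, ∀ σ : ℝ, f (τ n) ≤ σ →
      AnalyticAt ℂ (normalForm ζ) ((σ : ℂ) + (τ n : ℂ) * Complex.I) ∧
      ‖normalForm ζ ((σ : ℂ) + (τ n : ℂ) * Complex.I)‖ ≤ c * (|τ n| + 1) ^ M := by
  obtain ⟨M, c, hc, hle⟩ := h
  refine ⟨M, c, hc, fun n σ hσ => ?_⟩
  refine analyticAt_normalForm_of_norm_le hζ (l := 𝓝[>] σ)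
    (u := fun σ : ℝ => (σ : ℂ) + (τ n : ℂ) * Complex.I)
    (tendsto_nhdsGT_nhdsNE (by fun_prop) (fun x y hxy => by simpa using hxy) σ)
    tendsto_const_nhds ?_
  filter_upwards [self_mem_nhdsWithin] with x hx
  exact hle n x (hσ.trans (le_of_lt hx))

theorem IsStronglyLanguid.normalForm_curve (hζ : Meromorphic ζ) (h : IsStronglyLanguid ζ τ f A) :
    ∃ M c : ℝ, 0 < c ∧ ∀ m : ℕ, ∀ t : ℝ, AnalyticAt ℂ (normalForm ζ) (curve (f m) t) ∧
      ‖normalForm ζ (curve (f m) t)‖ ≤ c * A ^ |f m t| * (|t| + 1) ^ M := by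
  obtain ⟨M, c, hc, hle⟩ := h.bound
  obtain ⟨K, hK⟩ := h.uniform_lipschitz
  refine ⟨M, c, hc, fun m t => ?_⟩
  have hcont : Continuous fun t => c * A ^ |f m t| * (|t| + 1) ^ M := by
    have hfc : Continuous (f m) := (hK m).continuous
    refine (continuous_const.mul (Continuous.rpow continuous_const hfc.abs
      fun _ => Or.inl h.pos.ne')).mul ?_
    exact Continuous.rpow (by fun_prop) continuous_const fun t => Or.inl (by positivity)
  refine analyticAt_normalForm_of_norm_le hζ (l := 𝓝[>] t) (u := curve (f m))
    (tendsto_nhdsGT_nhdsNE (continuous_curve (hK m))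
      (fun x y hxy => by simpa using congrArg Complex.im hxy) t)
    ((hcont.tendsto t).mono_left nhdsWithin_le_nhds) (Eventually.of_forall fun x => hle m x)

theorem IsStronglyLanguid.le_iSup (h : IsStronglyLanguid ζ τ f A) (m : ℕ) (t : ℝ) :
    f m t ≤ ⨆ t, f m t := by
  obtain ⟨C, hC⟩ := (h.screens m).1
  refine le_ciSup (f := f m) ⟨C, ?_⟩ t
  rintro _ ⟨s, rfl⟩
  exact (le_abs_self _).trans (hC s)

theorem IsStronglyLanguid.analyticAt_height (hζ : Meromorphic ζ) (h : IsStronglyLanguid ζ τ f A)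
    {s : ℂ} {n : ℤ} (hs : s.im = τ n) : AnalyticAt ℂ (normalForm ζ) s := by
  obtain ⟨m, hm⟩ := (h.sup_tendsto.eventually_le_atBot s.re).exists
  obtain ⟨M, c, -, hle⟩ := (h.languid m).normalForm hζ
  have := (hle n s.re ((h.le_iSup m _).trans hm)).1
  rwa [← hs, Complex.re_add_im] at this

theorem finite_truncation (hζ : Meromorphic ζ) {d : ℕ} (hright : ∀ w ∈ scalingDimensions ζ, w.re ≤ d)
    {f : ℝ → ℝ} (hf : IsScreen f) (τ : ℤ → ℝ) (n : ℕ) :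
    (truncation (complexDimensions d ζ) τ f n).Finite := by
  obtain ⟨C, hC⟩ := hf.1
  have h1 := finite_not_analyticAt (meromorphic_normalForm ζ)
    (C + d + |τ (-(n : ℤ))| + |τ n|)
  have h2 : {w : ℂ | ∃ k : ℕ, k < d ∧ w = (k : ℂ)}.Finite := by
    refine ((Finset.range d).finite_toSet.image fun k : ℕ => (k : ℂ)).subset ?_
    rintro w ⟨k, hk, rfl⟩
    exact ⟨k, by simpa using hk, rfl⟩
  refine (h1.union h2).subset ?_
  rintro w ⟨hw | hw, hwin, hlo, hhi⟩
  · refine Or.inl ⟨?_, fun hA => (analyticAt_normalForm_iff hζ).1 hA hw⟩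
    have hre := hright w hw
    have hlow := (abs_le.1 (hC w.im)).1
    have hC0 := (abs_nonneg _).trans (hC w.im)
    have hwin' : f w.im ≤ w.re := hwin
    have h3 : |w.re| ≤ C + d := abs_le.2 ⟨by linarith [(Nat.cast_nonneg d : (0 : ℝ) ≤ d)],
      by linarith⟩
    have h4 : |w.im| ≤ |τ (-(n : ℤ))| + |τ n| := abs_le.2
      ⟨by linarith [neg_abs_le (τ (-(n : ℤ))), abs_nonneg (τ n)],
        by linarith [le_abs_self (τ n), abs_nonneg (τ (-(n : ℤ)))]⟩
    rw [mem_closedBall_zero_iff]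
    linarith [Complex.norm_le_abs_re_add_abs_im w]
  · exact Or.inr hw

end

section

variable {d : ℕ} {ι : Type*} [Countable ι] {G T : Set (E d)} {ρ : ι → ℝ} {κ : ℕ → ℝ}
  {ζ : ℂ → ℂ} {τ : ℤ → ℝ} {f : ℝ → ℝ} {φ : ℝ → ℂ} {a b : ℝ}

/-- The residue of the tested tubular zeta function at the dimension of the ambient space. -/
theorem residue_testedZeta_dimension (hd : 1 ≤ d) (ha : 0 < a) (hφ : Continuous φ)
    (hs : tsupport φ ⊆ Ioo a b) (hG : IsGenerator G) (hκ : IsMonophase G κ)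
    (hT : IsFractalSpray G ρ T) (hζ : IsScalingZeta (scalingMeasure ρ) ζ) :
    residue (testedZeta d (inradius G) κ ζ φ) d =
      -((volume T).toReal * ∫ ε in Ioi (0 : ℝ), φ ε) := by
  have hsum := hT.summable_pow hG
  obtain ⟨hA, hZ⟩ := normalForm_natCast hd hT.pos hsum hζ
  rw [residue_testedZeta_natCast (hG.inradius_pos hd) (differentiable_testTransform ha hφ hs d) hA,
    hZ, testTransform_eq, hκ.top, ← hT.hasSum_volume.tsum_eq, tsum_mul_right]
  simp only [sub_self, Complex.cpow_zero, one_mul]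
  push_cast
  ring

theorem action_tubeVolume (hφ : Integrable φ) (hT : volume T ≠ ⊤) :
    action (fun ε => (tubeVolume T ε : ℂ)) φ =
      (∫ ε in Ioi (0 : ℝ), ((tubeVolume T ε - (volume T).toReal : ℝ) : ℂ) * φ ε) +
        (volume T).toReal * ∫ ε in Ioi (0 : ℝ), φ ε := by
  have hm : Measurable fun ε => (tubeVolume T ε : ℂ) :=
    Complex.measurable_ofReal.comp (monotone_tubeVolume hT).measurable
  have hint : IntegrableOn (fun ε => (tubeVolume T ε : ℂ) * φ ε) (Ioi 0) := by
    refine hφ.integrableOn.bdd_mul (c := (volume T).toReal) hm.aestronglyMeasurable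
      (ae_of_all _ fun ε => ?_)
    rw [Complex.norm_real, Real.norm_of_nonneg (tubeVolume_nonneg T ε)]
    exact tubeVolume_le hT ε
  have h2 : ∫ ε in Ioi (0 : ℝ), ((tubeVolume T ε - (volume T).toReal : ℝ) : ℂ) * φ ε =
      (∫ ε in Ioi (0 : ℝ), (tubeVolume T ε : ℂ) * φ ε) -
        ∫ ε in Ioi (0 : ℝ), (volume T).toReal * φ ε := by
    rw [← integral_sub hint (hφ.integrableOn.const_mul _)]
    refine integral_congr_ae (ae_of_all _ fun ε => ?_)
    push_cast
    ring
  rw [h2, integral_const_mul, action, sub_add_cancel]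

/-- The sum of the residues at the visible complex dimensions, as a boundary integral. -/
theorem finsum_residue_truncation (hζ : Meromorphic ζ) {g : ℝ} (hg : 0 < g)
    (hφ : Differentiable ℂ (testTransform d φ))
    (hright : ∀ s : ℂ, (d : ℝ) < s.re → AnalyticAt ℂ (normalForm ζ) s)
    (hdim : AnalyticAt ℂ (normalForm ζ) d) (hf : IsScreen f) (hneg : ∀ t, f t < 0)
    (hcurve : ∀ t, AnalyticAt ℂ (normalForm ζ) (curve f t)) {n : ℕ}
    (hlo : τ (-(n : ℤ)) < 0) (hhi : 0 < τ n)
    (hheight : ∀ s : ℂ, s.im = τ (-(n : ℤ)) ∨ s.im = τ n → AnalyticAt ℂ (normalForm ζ) s) :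
    2 * Real.pi * Complex.I * ((∑ᶠ w ∈ truncation (complexDimensions d ζ) τ f n,
        distResidue (tubularZeta d g κ ζ) w φ) + residue (testedZeta d g κ ζ φ) d) =
      straightIntegral f (d + 1) (τ (-(n : ℤ))) (τ n) (testedZeta d g κ ζ φ) -
        screenIntegral f (τ (-(n : ℤ))) (τ n) (testedZeta d g κ ζ φ) := by
  classical
  obtain ⟨K, hK⟩ := hf.2
  have hd0 : (0 : ℝ) ≤ d := Nat.cast_nonneg d
  have hdimtop : ∀ w ∈ scalingDimensions ζ, w.re ≤ d := fun w hw => by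
    by_contra h
    exact (analyticAt_normalForm_iff hζ).1 (hright w (not_le.1 h)) hw
  obtain ⟨P, hP, hsum⟩ := two_pi_I_mul_sum_residue (F := testedZeta d g κ ζ φ) (c := d + 1) hK
    (hlo.le.trans hhi.le) (fun t => by linarith [hneg t]) (meromorphic_testedZeta hg hφ)
    (fun t => analyticAt_testedZeta hg hφ (hcurve t) fun k _ h => by
      have := congrArg Complex.re h
      rw [curve_re, Complex.natCast_re] at this
      linarith [hneg t, (Nat.cast_nonneg k : (0 : ℝ) ≤ k)])
    (fun s hs => analyticAt_testedZeta hg hφ (hright s (by linarith)) fun k hk h => by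
      rw [h, Complex.natCast_re] at hs
      have : (k : ℝ) ≤ d := by exact_mod_cast hk
      linarith)
    (fun s hs => analyticAt_testedZeta hg hφ (hheight s hs) fun k _ h => by
      rw [h, Complex.natCast_im] at hs
      rcases hs with hs | hs <;> linarith)
  rw [← hsum]
  congr 1
  have hfin := finite_truncation hζ hdimtop hf τ n
  have hdnot : (d : ℂ) ∉ hfin.toFinset := by
    rw [hfin.mem_toFinset]
    rintro ⟨h | ⟨k, hk, h⟩, -⟩
    · exact (analyticAt_normalForm_iff hζ).1 hdim h
    · have : d = k := by exact_mod_cast h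
      omega
  rw [finsum_mem_eq_finite_toFinset_sum _ hfin, add_comm]
  simp_rw [distResidue_tubularZeta hζ]
  rw [← Finset.sum_insert (f := fun w => residue (testedZeta d g κ ζ φ) w) hdnot]
  symm
  refine Finset.sum_subset (fun w hw => ?_) fun w hw hwP => ?_
  · obtain ⟨hwA, hwin, h1, h2⟩ := (hP w).1 hw
    rw [Finset.mem_insert, hfin.mem_toFinset]
    by_contra hcon
    rw [not_or] at hcon
    refine hwA (analyticAt_testedZeta hg hφ ?_ fun k hk h => ?_)
    · rw [analyticAt_normalForm_iff hζ]
      exact fun h => hcon.2 ⟨Or.inl h, hwin, h1, h2⟩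
    · rcases hk.lt_or_eq with hk | rfl
      · exact hcon.2 ⟨Or.inr ⟨k, hk, h⟩, hwin, h1, h2⟩
      · exact hcon.1 h
  · refine residue_eq_zero_of_analyticAt ?_
    by_contra hwA
    refine hwP ((hP w).2 ⟨hwA, ?_⟩)
    rcases Finset.mem_insert.1 hw with rfl | hw
    · rw [Complex.natCast_im, Complex.natCast_re]
      exact ⟨by linarith [hneg 0], hlo, hhi⟩
    · exact ((hfin.mem_toFinset).1 hw).2

end

end FractalSpray

theorem corollary8p1 {d : ℕ} (hd : 1 ≤ d) {ι : Type*} [Countable ι]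
    (G T : Set (FractalSpray.E d)) (ρ : ι → ℝ) (κ : ℕ → ℝ)
    (hG : FractalSpray.IsGenerator G)
    (hκ : FractalSpray.IsMonophase G κ)
    (hT : FractalSpray.IsFractalSpray G ρ T)
    (ζ : ℂ → ℂ)
    (hζ : FractalSpray.IsScalingZeta (FractalSpray.scalingMeasure ρ) ζ)
    (τ : ℤ → ℝ) (f : ℕ → ℝ → ℝ) (A : ℝ)
    (hL : FractalSpray.IsStronglyLanguid ζ τ f A)
    (φ : ℝ → ℂ)
    (hφ : FractalSpray.IsTestFunction (Set.Ioo 0 (FractalSpray.inradius G / A)) φ) :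
    FractalSpray.HasDimensionSum (FractalSpray.complexDimensions d ζ) τ f
      (fun w => FractalSpray.distResidue
        (FractalSpray.tubularZeta d (FractalSpray.inradius G) κ ζ) w φ)
      (FractalSpray.action (fun ε => (FractalSpray.tubeVolume T ε : ℂ)) φ) := by
  open FractalSpray in
  have hg : 0 < inradius G := hG.inradius_pos hd
  have hmer := hζ.meromorphic
  have hsum := hT.summable_pow hG
  obtain ⟨a, b, ha, hab, hbR, hs⟩ := exists_Ioo_of_isTestFunction (div_pos hg hL.pos) hφ
  have hb : 0 < b := ha.trans_le hab
  have hφd := differentiable_testTransform ha hφ.smooth.continuous hs d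
  have hright : ∀ s : ℂ, (d : ℝ) < s.re → AnalyticAt ℂ (normalForm ζ) s := fun s h =>
    analyticAt_normalForm_of_lt_re hd hT.pos hsum hζ h
  have hdim := (normalForm_natCast hd hT.pos hsum hζ).1
  have hdimtop : ∀ w ∈ scalingDimensions ζ, w.re ≤ d := fun w hw => by
    by_contra h
    exact (analyticAt_normalForm_iff hmer).1 (hright w (not_le.1 h)) hw
  refine ⟨fun m n => finite_truncation hmer hdimtop (hL.screens m) τ n, ?_⟩
  obtain ⟨K, hK⟩ := hL.uniform_lipschitz
  obtain ⟨M, c, hc, hcurve⟩ := hL.normalForm_curve hmer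
  obtain ⟨B, hB, hBle⟩ := exists_norm_testedZeta_curve_le (ζ := ζ) hg ha hab hφ.smooth hs hL.pos hbR
    κ d hc.le M
  set F := testedZeta d (inradius G) κ ζ φ with hF
  set p : ℕ → ℝ := fun m => -⨆ t, f m t with hp
  have hfp : ∀ m t, f m t ≤ -p m := fun m t => by
    simpa [hp] using hL.le_iSup m t
  have hptop : Tendsto p atTop atTop := tendsto_neg_atBot_atTop.comp hL.sup_tendsto
  set q := A * b / inradius G with hq
  set S := ∫ t : ℝ, ((1 + |t|) ^ 2)⁻¹ with hS
  have hpi : (2 * Real.pi * Complex.I : ℂ) ≠ 0 := Complex.two_pi_I_ne_zero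
  have hscreen : ∀ m, ∃ J : ℂ, 1 ≤ p m →
      Tendsto (fun n : ℕ => screenIntegral (f m) (τ (-(n : ℤ))) (τ n) F) atTop (𝓝 J) ∧
      ‖J‖ ≤ (K + 1) * (B * q ^ p m) * S := by
    intro m
    by_cases hm : 1 ≤ p m
    · have hneg : ∀ t, f m t < 0 := fun t => by linarith [hfp m t]
      obtain ⟨J, hJ⟩ := tendsto_screenIntegral (hK m) (F := F)
        (fun t => analyticAt_testedZeta hg hφd (hcurve m t).1 fun k _ h => by
          have := congrArg Complex.re h
          rw [curve_re, Complex.natCast_re] at this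
          linarith [hneg t, (Nat.cast_nonneg k : (0 : ℝ) ≤ k)])
        (hBle (f m) (p m) hm (hfp m) fun t => (hcurve m t).2)
        hL.heights.tendsto_bot hL.heights.tendsto_top
      exact ⟨J, fun _ => hJ⟩
    · exact ⟨0, fun h => absurd h hm⟩
  choose J hJ using hscreen
  obtain ⟨hlineInt, hline⟩ := integral_testedZeta_line hd ha hab hφ.smooth hs hG hκ hT hζ
  set W := ∫ ε in Set.Ioi (0 : ℝ), ((tubeVolume T ε - (volume T).toReal : ℝ) : ℂ) * φ ε with hW
  have hvalue : action (fun ε => (tubeVolume T ε : ℂ)) φ = W - residue F d := by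
    rw [action_tubeVolume (integrable_of_tsupport_subset hφ.smooth.continuous hs)
      hT.isBounded.measure_lt_top.ne, hF,
      residue_testedZeta_dimension hd ha hφ.smooth.continuous hs hG hκ hT hζ, sub_neg_eq_add]
  refine ⟨fun m => W - J m / (2 * Real.pi * Complex.I) - residue F d, ?_, ?_⟩
  · filter_upwards [hptop.eventually_ge_atTop 1] with m hm
    have hneg : ∀ t, f m t < 0 := fun t => by linarith [hfp m t]
    obtain ⟨C, hC⟩ := (hL.screens m).1
    obtain ⟨M', c', hc', hhor⟩ := (hL.languid m).normalForm hmer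
    have hle : ∀ t, f m t ≤ (d : ℝ) + 1 := fun t => by
      linarith [hneg t, (Nat.cast_nonneg d : (0 : ℝ) ≤ d)]
    have htop : Tendsto (fun n : ℕ => ∫ σ in (f m (τ n))..((d : ℝ) + 1),
        F (σ + τ n * Complex.I)) atTop (𝓝 0) :=
      tendsto_integral_horizontal (y := fun n : ℕ => τ n) (x := fun n : ℕ => f m (τ n)) hg ha hab
        hφ.smooth hs (tendsto_abs_atTop_atTop.comp hL.heights.tendsto_top) (fun n => hC _)
        (fun n => hle _) hc'.le fun n σ h => (hhor n σ h).2
    have hbot : Tendsto (fun n : ℕ => ∫ σ in (f m (τ (-(n : ℤ))))..((d : ℝ) + 1),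
        F (σ + τ (-(n : ℤ)) * Complex.I)) atTop (𝓝 0) :=
      tendsto_integral_horizontal (y := fun n : ℕ => τ (-(n : ℤ)))
        (x := fun n : ℕ => f m (τ (-(n : ℤ)))) hg ha hab
        hφ.smooth hs (tendsto_abs_atBot_atTop.comp hL.heights.tendsto_bot) (fun n => hC _)
        (fun n => hle _) hc'.le fun n σ h => (hhor (-n) σ h).2
    have hvert : Tendsto (fun n : ℕ => ∫ t in (τ (-(n : ℤ)))..(τ n),
        F (((d + 1 : ℝ) : ℂ) + t * Complex.I)) atTop (𝓝 (2 * Real.pi * W)) := by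
      rw [← hline]
      exact intervalIntegral_tendsto_integral hlineInt hL.heights.tendsto_bot
        hL.heights.tendsto_top
    have hlim := (((hbot.add (hvert.const_mul Complex.I)).sub htop).sub (hJ m hm).1).div_const
      (2 * Real.pi * Complex.I)
    have hlim' := hlim.sub_const (residue F d)
    have hval : (0 + Complex.I * (2 * Real.pi * W) - 0 - J m) / (2 * Real.pi * Complex.I) -
        residue F d = W - J m / (2 * Real.pi * Complex.I) - residue F d := by
      rw [zero_add, sub_zero, sub_div]
      congr 2
      rw [show Complex.I * (2 * Real.pi * W) = (2 * Real.pi * Complex.I) * W by ring,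
        mul_div_cancel_left₀ _ hpi]
    rw [hval] at hlim'
    refine hlim'.congr' ?_
    filter_upwards [eventually_ge_atTop 1] with n hn
    have hkey := finsum_residue_truncation (κ := κ) hmer hg hφd hright hdim (hL.screens m) hneg
      (fun t => (hcurve m t).1) (hL.heights.neg n hn) (hL.heights.pos n hn)
      (fun s h => h.elim (fun h => hL.analyticAt_height hmer h)
        fun h => hL.analyticAt_height hmer h)
    rw [← hF, straightIntegral] at hkey
    rw [← hkey, mul_div_cancel_left₀ _ hpi, add_sub_cancel_right]
  · have hq0 : 0 < q := div_pos (mul_pos hL.pos hb) hg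
    have hq1 : q < 1 := by
      rw [hq, div_lt_one hg, mul_comm]
      exact (lt_div_iff₀ hL.pos).1 hbR
    have hJ0 : Tendsto J atTop (𝓝 0) := by
      refine squeeze_zero_norm' (a := fun m => (K + 1) * (B * q ^ p m) * S) ?_ ?_
      · filter_upwards [hptop.eventually_ge_atTop 1] with m hm using (hJ m hm).2
      · have h0 : Tendsto (fun m => q ^ p m) atTop (𝓝 0) :=
          (tendsto_rpow_atTop_of_base_lt_one q (by linarith) hq1).comp hptop
        simpa using ((h0.const_mul B).const_mul ((K : ℝ) + 1)).mul_const S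
    have := ((hJ0.div_const (2 * Real.pi * Complex.I)).const_sub W).sub_const (residue F d)
    rw [hvalue]
    simpa using this
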